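/- Let $0<\alpha_1<\alpha_2<2$ and let $G_1,G_2$ be probability laws on $\mathbb R$ such that, for $j=1,2$, $G_j$ is in the domain of normal attraction of the symmetric stable law with characteristic function $t\mapsto\exp(-c_j|t|^{\alpha_j})$, $c_j>0$. This means: if $Z_1,Z_2,\dots$ are i.i.d. with law $G_j$, then for some real constants $d_j(n)$ the variables $n^{-1/\alpha_j}\bigl(Z_1+\dots+Z_n-d_j(n)\bigr)$ converge in distribution to that stable law, where, as usual, the centering is taken to be $d_j(n)=0$ for all $n$ whenever $\alpha_j\neq 1$ (so $G_j$ has mean $0$ if $\alpha_j>1$). Let $X_1,X_2,\dots$ be independent random variables, each with law $G_1$ or $G_2$, put $S_n=X_1+\dots+X_n$, let $\tau_j(n)$ be the number of $k\le n$ such that $X_k$ has law $G_j$, and assume $\tau_1(n)\to\infty$ and $\tau_2(n)\to\infty$. Let $A_n\in\mathbb R$ and $B_n>0$ be such that $(S_n-A_n)/B_n$ converges in distribution to a non-degenerate law, and let $$\lambda=\lim_{n\to\infty}\frac{\tau_1(n)^{\alpha_2}}{\tau_2(n)^{\alpha_1}}\in[0,\infty].$$ Let $f:[1,\infty)\to(0,\infty)$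 be nondecreasing. (a) If $0<\lambda\le\infty$, then with probability one $$\limsup_{n\to\infty}\frac{|S_n|}{B_n f(n)^{1/\alpha_1}}=0\iff\int_1^\infty\frac{dx}{x f(x)}<\infty,\qquad \limsup_{n\to\infty}\frac{|S_n|}{B_n f(n)^{1/\alpha_1}}=\infty\iff\int_1^\infty\frac{dx}{x f(x)}=\infty .$$ (b) If $\lambda=0$ and there is $\mu>(\alpha_2-\alpha_1)/\alpha_2$ such that $\tau_1(n)<n^{\alpha_1/\alpha_2}(\log n)^{-\mu}$ for all sufficiently large $n$, then with probability one $$\limsup_{n\to\infty}\frac{|S_n|}{B_n f(n)^{1/\alpha_2}}=0\iff\int_1^\infty\frac{dx}{x f(x)}<\infty,\qquad \limsup_{n\to\infty}\frac{|S_n|}{B_n f(n)^{1/\alpha_2}}=\infty\iff\int_1^\infty\frac{dx}{x f(x)}=\infty .$$ -/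

import Mathlib

open MeasureTheory ProbabilityTheory Filter Topology
open scoped ENNReal

noncomputable section

/-- `ν` is the symmetric stable law on `ℝ` with index `α` and scale parameter `c`, i.e. the
probability law with characteristic function `t ↦ exp (-c |t| ^ α)`. -/
structure IsSymmStableLaw (α c : ℝ) (ν : Measure ℝ) : Prop where
  isProbabilityMeasure : IsProbabilityMeasure ν
  charFun_eq : ∀ t : ℝ, charFun ν t = ((Real.exp (-(c * |t| ^ α)) : ℝ) : ℂ)

/-- The law `G` is in the domain of normal attraction of the symmetric stable law with index `α`
and scale `c`: if `Z₀, Z₁, …` are i.i.d. with law `G` (realised here as the coordinates on the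
infinite product space), then `(Z₀ + ⋯ + Z_{n-1} - d n) / n ^ (1 / α)` converges in distribution to
that stable law, where the centering constants `d n` are zero unless `α = 1`. -/
def InDomainOfNormalAttraction (G : Measure ℝ) [IsProbabilityMeasure G] (α c : ℝ) : Prop :=
  ∃ (ν : Measure ℝ) (_ : IsProbabilityMeasure ν) (d : ℕ → ℝ),
    IsSymmStableLaw α c ν ∧ (α ≠ 1 → ∀ n, d n = 0) ∧
    TendstoInDistribution
      (fun (n : ℕ) (z : ℕ → ℝ) => ((∑ k ∈ Finset.range n, z k) - d n) / (n : ℝ) ^ (1 / α))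
      atTop (id : ℝ → ℝ) (fun _ => Measure.infinitePi (fun _ : ℕ => G)) ν

/-- Partial sums: the sum of the first `n` members of the sequence `X`. -/
def partialSum {Ω : Type*} (X : ℕ → Ω → ℝ) (n : ℕ) (ω : Ω) : ℝ :=
  ∑ k ∈ Finset.range n, X k ω

open Classical in
/-- The number of variables with law `G` among the first `n` members of the sequence `X`. -/
def sampleCount {Ω : Type*} [MeasurableSpace Ω] (P : Measure Ω) (X : ℕ → Ω → ℝ)
    (G : Measure ℝ) (n : ℕ) : ℕ :=
  ((Finset.range n).filter (fun k => P.map (X k) = G)).card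

/-- `limsup |S_n| / (B_n f(n) ^ (1 / α))`, as an element of `[0, ∞]`. -/
def normedLimsup {Ω : Type*} (X : ℕ → Ω → ℝ) (B : ℕ → ℝ) (f : ℝ → ℝ) (α : ℝ) (ω : Ω) : ℝ≥0∞ :=
  limsup (fun n : ℕ => ENNReal.ofReal (|partialSum X n ω| / (B n * f n ^ (1 / α)))) atTop

/-- `∫_1^∞ dx / (x f(x))`, as an element of `[0, ∞]`. -/
def logIntegral (f : ℝ → ℝ) : ℝ≥0∞ :=
  ∫⁻ x in Set.Ioi (1 : ℝ), ENNReal.ofReal (1 / (x * f x))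

end

/-! One of the two types of summand dominates: law `G₁` in (a), law `G₂` in (b). Let α be its index,
α' the other index, and N_n the number of its members among the first n variables. Then B_n is of
exact order (N_n + 1)^(1/α), so S_n can be normed by w_n = ((N + 1) f)^(1/α), which is `normSeq`,
and the claim becomes a pair of Borel–Cantelli arguments.

The order of B_n comes from moduli of characteristic functions, which do not see the centering. If
B_n were much larger than N_n^(1/α), every factor at t / B_n would be close to 1 and the limit would
be degenerate (`exists_eventually_norming_le`). If it were much smaller, the factors of the dominant
type alone would spoil equicontinuity at 0 (`exists_eventually_le_norming`). Normal attraction also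
yields two-sided bounds of order x^(-α) for the tail of each law, through symmetrization
(`exists_tail_le`, `exists_le_tail`).

If the integral converges, the sum of w_k^(-α) over the dominant type is finite: N runs through the
integers along that type and N ≤ k, so the series is dominated by Σ 1/(m f(m)). For the other type,
Σ w_k^(-α') is finite because N' = O(N^(α'/α)) in (a); in (b) it follows from the sparseness
condition and f ≥ log, the exponent of the logarithm being μ + α₁/α₂ > 1. Truncation at w_k,
Kolmogorov's series theorem, Kronecker's lemma and Borel–Cantelli then give S_n / w_n → 0
(`ae_tendsto_sum_ite_div`). Truncated means at index 1 grow logarithmically and are treated apart.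

If the integral diverges, k is at most a fixed power of N along the dominant type, and divergence
survives the substitution of x^p in f. The second Borel–Cantelli lemma gives |X_k| > M w_k
infinitely often for every M (`ae_frequently_lt_abs`). Since X_k is a difference of consecutive
partial sums, those cannot be O(w_k). -/

/-! ### Deterministic series: Kronecker's lemma and reindexing by counts -/

/-- **Kronecker's lemma**. -/
theorem tendsto_sum_div_of_tendsto_sum_div {w x : ℕ → ℝ} (hw : Monotone w) (hpos : ∀ k, 0 < w k)
    (htop : Tendsto w atTop atTop) {l : ℝ}
    (h : Tendsto (fun n => ∑ k ∈ Finset.range n, x k / w k) atTop (𝓝 l)) :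
    Tendsto (fun n => (∑ k ∈ Finset.range (n + 1), x k) / w n) atTop (𝓝 0) := by
  set s : ℕ → ℝ := fun n => ∑ k ∈ Finset.range n, x k / w k with hs
  set g : ℕ → ℝ := fun k => w (k + 1) - w k with hg
  have hgsum : ∀ n, ∑ k ∈ Finset.range n, g k = w n - w 0 := fun n => Finset.sum_range_sub w n
  have hs1 : Tendsto (fun n => s (n + 1) - l) atTop (𝓝 0) := by
    simpa using ((tendsto_add_atTop_iff_nat 1).2 h).sub_const l
  -- Abel summation. Subtracting the limit `l` makes the weighted terms a null sequence, so that a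
  -- weighted Cesàro average finishes the proof.
  have habel : ∀ n, ∑ k ∈ Finset.range (n + 1), x k =
      w n * (s (n + 1) - l) - ∑ k ∈ Finset.range n, g k * (s (k + 1) - l) + l * w 0 := by
    intro n
    induction n with
    | zero =>
      have h0 := (hpos 0).ne'
      simp [hs]
      field_simp
      ring
    | succ n ih =>
      rw [Finset.sum_range_succ, ih, Finset.sum_range_succ _ n]
      have h1 : s (n + 1 + 1) = s (n + 1) + x (n + 1) / w (n + 1) := by
        simp only [hs]; rw [Finset.sum_range_succ _ (n + 1)]
      have h0 := (hpos (n + 1)).ne'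
      rw [h1]
      simp only [hg]
      field_simp
      ring
  have hsumtop : Tendsto (fun n => ∑ k ∈ Finset.range n, g k) atTop atTop := by
    simp_rw [hgsum]
    exact tendsto_atTop_add_const_right _ _ htop
  have ho : (fun k => g k * (s (k + 1) - l)) =o[atTop] g := by
    have := (Asymptotics.isBigO_refl g atTop).mul_isLittleO
      ((Asymptotics.isLittleO_one_iff ℝ).2 hs1)
    simpa using this
  have ho2 := ho.sum_range (fun k => sub_nonneg.2 (hw (Nat.le_succ k))) hsumtop
  have hO : (fun n => ∑ k ∈ Finset.range n, g k) =O[atTop] w := by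
    refine Asymptotics.IsBigO.of_bound 1 (Eventually.of_forall fun n => ?_)
    rw [hgsum, Real.norm_of_nonneg (sub_nonneg.2 (hw (Nat.zero_le n))),
      Real.norm_of_nonneg (hpos n).le]
    linarith [hpos 0]
  have h3 := (ho2.trans_isBigO hO).tendsto_div_nhds_zero
  have h4 : Tendsto (fun n => l * w 0 / w n) atTop (𝓝 0) := tendsto_const_nhds.div_atTop htop
  have := (hs1.sub h3).add h4
  simp only [sub_zero, add_zero] at this
  refine this.congr fun n => ?_
  rw [habel]
  have h0 := (hpos n).ne'
  field_simp

section Count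
variable (p : ℕ → Prop) [DecidablePred p]

/-- `Nat.count p k` counts strictly before `k`, so along the indices satisfying `p` it takes the
values 0, 1, 2, … once each. -/
theorem sum_ite_count (h : ℕ → ℝ) (n : ℕ) :
    ∑ k ∈ Finset.range n, (if p k then h (Nat.count p k) else 0) =
      ∑ m ∈ Finset.range (Nat.count p n), h m := by
  induction n with
  | zero => simp
  | succ n ih =>
    rw [Finset.sum_range_succ, ih, Nat.count_succ]
    by_cases hp : p n
    · simp [hp, Finset.sum_range_succ]
    · simp [hp]

variable {p}

theorem summable_ite_count {h : ℕ → ℝ} (h0 : ∀ m, 0 ≤ h m) (hs : Summable h) :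
    Summable fun k => if p k then h (Nat.count p k) else 0 := by
  refine summable_of_sum_range_le (c := ∑' m, h m) (fun k => ?_) fun n => ?_
  · split_ifs
    exacts [h0 _, le_rfl]
  · rw [sum_ite_count]
    exact hs.sum_le_tsum _ fun i _ => h0 i

/-- Divergence of the count to infinity ensures that every term of `h` is eventually reached. -/
theorem summable_of_summable_ite_count {h : ℕ → ℝ} (h0 : ∀ m, 0 ≤ h m)
    (hp : Tendsto (Nat.count p) atTop atTop)
    (hs : Summable fun k => if p k then h (Nat.count p k) else 0) : Summable h := by
  refine summable_of_sum_range_le (c := ∑' k, if p k then h (Nat.count p k) else 0) h0 fun N => ?_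
  obtain ⟨n, hn⟩ := (hp.eventually_ge_atTop N).exists
  calc ∑ m ∈ Finset.range N, h m ≤ ∑ m ∈ Finset.range (Nat.count p n), h m :=
        Finset.sum_le_sum_of_subset_of_nonneg (Finset.range_mono hn) fun i _ _ => h0 i
    _ = _ := (sum_ite_count p h n).symm
    _ ≤ _ := hs.sum_le_tsum _ fun i _ => by split_ifs; exacts [h0 _, le_rfl]

end Count

/-! ### The integral test in dyadic form -/

section LogIntegral
variable {f : ℝ → ℝ} (hfpos : ∀ x, 1 ≤ x → 0 < f x) (hfmono : MonotoneOn f (Set.Ici 1))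
include hfpos hfmono

theorem inv_antitone_two_pow : Antitone fun i : ℕ => 1 / f (2 ^ i) := by
  intro i j hij
  have h1 : (1 : ℝ) ≤ 2 ^ i := one_le_pow₀ (by norm_num)
  have h2 : (2 : ℝ) ^ i ≤ 2 ^ j := pow_le_pow_right₀ (by norm_num) hij
  exact one_div_le_one_div_of_le (hfpos _ h1) (hfmono h1 (h1.trans h2) h2)

/-- On (2^i, 2^(i+1)] the integrand is at least its value at the right endpoint, so this block
contributes at least 1/(2 f(2^(i+1))). -/
theorem summable_of_logIntegral_lt_top (h : logIntegral f < ∞) :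
    Summable fun i : ℕ => 1 / f (2 ^ i) := by
  rw [← summable_nat_add_iff 1]
  have hpow : Monotone fun i : ℕ => (2 : ℝ) ^ i := pow_right_mono₀ (by norm_num)
  have hdisj : Pairwise (Function.onFun Disjoint fun i : ℕ => Set.Ioc ((2 : ℝ) ^ i) (2 ^ (i + 1))) := by
    simpa using hpow.pairwise_disjoint_on_Ioc_succ
  have hpos' : ∀ i : ℕ, 0 ≤ 1 / f (2 ^ (i + 1)) := fun i =>
    (one_div_pos.2 (hfpos _ (one_le_pow₀ (by norm_num)))).le
  have key : ∑' i : ℕ, ENNReal.ofReal (1 / f (2 ^ (i + 1)) / 2) ≤ logIntegral f := by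
    calc ∑' i : ℕ, ENNReal.ofReal (1 / f (2 ^ (i + 1)) / 2)
        ≤ ∑' i : ℕ, ∫⁻ x in Set.Ioc ((2 : ℝ) ^ i) (2 ^ (i + 1)), ENNReal.ofReal (1 / (x * f x)) := by
          refine ENNReal.tsum_le_tsum fun i => ?_
          have h1 : (1 : ℝ) ≤ 2 ^ (i + 1) := one_le_pow₀ (by norm_num)
          have h2 : (1 : ℝ) ≤ 2 ^ i := one_le_pow₀ (by norm_num)
          calc ENNReal.ofReal (1 / f (2 ^ (i + 1)) / 2)
              = ∫⁻ x in Set.Ioc ((2 : ℝ) ^ i) (2 ^ (i + 1)),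
                  ENNReal.ofReal (1 / (2 ^ (i + 1) * f (2 ^ (i + 1)))) := by
                rw [setLIntegral_const, Real.volume_Ioc, ← ENNReal.ofReal_mul
                  (one_div_pos.2 (mul_pos (by positivity) (hfpos _ h1))).le]
                congr 1
                have := (hfpos _ h1).ne'
                field_simp
                ring
            _ ≤ _ := by
                refine setLIntegral_mono' measurableSet_Ioc fun x hx => ?_
                have hx1 : 1 ≤ x := h2.trans hx.1.le
                apply ENNReal.ofReal_le_ofReal
                apply one_div_le_one_div_of_le (mul_pos (by linarith) (hfpos _ hx1))
                exact mul_le_mul hx.2 (hfmono hx1 h1 hx.2) (hfpos _ hx1).le (by positivity)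
      _ = ∫⁻ x in ⋃ i : ℕ, Set.Ioc ((2 : ℝ) ^ i) (2 ^ (i + 1)), ENNReal.ofReal (1 / (x * f x)) :=
          (lintegral_iUnion (fun _ => measurableSet_Ioc) hdisj _).symm
      _ ≤ _ := by
          refine lintegral_mono_set (Set.iUnion_subset fun i x hx => ?_)
          exact lt_of_le_of_lt (one_le_pow₀ (by norm_num)) hx.1
  have hs := ENNReal.summable_toReal (key.trans_lt h).ne
  have := hs.mul_left 2
  refine this.congr fun i => ?_
  rw [ENNReal.toReal_ofReal (by have := hpos' i; positivity)]
  ring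

theorem logIntegral_lt_top_of_summable (h : Summable fun i : ℕ => 1 / f (2 ^ i)) :
    logIntegral f < ∞ := by
  have hcover : Set.Ioi (1 : ℝ) ⊆ ⋃ i : ℕ, Set.Ico ((2 : ℝ) ^ i) (2 ^ (i + 1)) := by
    intro x hx
    obtain ⟨n, hn1, hn2⟩ := exists_nat_pow_near (le_of_lt hx) (one_lt_two (α := ℝ))
    exact Set.mem_iUnion.2 ⟨n, hn1, hn2⟩
  have key : logIntegral f ≤ ∑' i : ℕ, ENNReal.ofReal (1 / f (2 ^ i)) := by
    calc logIntegral f ≤ _ := lintegral_mono_set hcover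
      _ ≤ _ := lintegral_iUnion_le _ _
      _ ≤ _ := by
        refine ENNReal.tsum_le_tsum fun i => ?_
        have h2 : (1 : ℝ) ≤ 2 ^ i := one_le_pow₀ (by norm_num)
        calc _ ≤ ∫⁻ x in Set.Ico ((2 : ℝ) ^ i) (2 ^ (i + 1)),
                  ENNReal.ofReal (1 / (2 ^ i * f (2 ^ i))) := by
                refine setLIntegral_mono' measurableSet_Ico fun x hx => ?_
                have hx1 : 1 ≤ x := h2.trans hx.1
                apply ENNReal.ofReal_le_ofReal
                apply one_div_le_one_div_of_le (mul_pos (by positivity) (hfpos _ h2))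
                exact mul_le_mul hx.1 (hfmono h2 hx1 hx.1) (hfpos _ h2).le (by linarith)
          _ = _ := by
                rw [setLIntegral_const, Real.volume_Ico, ← ENNReal.ofReal_mul
                  (one_div_pos.2 (mul_pos (by positivity) (hfpos _ h2))).le]
                congr 1
                have := (hfpos _ h2).ne'
                field_simp
                ring
  refine key.trans_lt (lt_of_le_of_ne le_top ?_)
  exact h.tsum_ofReal_ne_top

/-- Cauchy condensation: the weight 2^i cancels the factor m at m = 2^i. -/
theorem summable_one_div_mul_pow_iff (p : ℕ) :
    (Summable fun m : ℕ => 1 / (((m : ℝ) + 1) * f (((m : ℝ) + 1) ^ p))) ↔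
      Summable fun i : ℕ => 1 / f (2 ^ (p * i)) := by
  have h1 : (Summable fun m : ℕ => 1 / (((m : ℝ) + 1) * f (((m : ℝ) + 1) ^ p))) ↔
      Summable fun m : ℕ => if m = 0 then 0 else 1 / ((m : ℝ) * f ((m : ℝ) ^ p)) := by
    rw [← summable_nat_add_iff (f := fun m : ℕ => if m = 0 then (0 : ℝ) else
      1 / ((m : ℝ) * f ((m : ℝ) ^ p))) 1]
    simp
  rw [h1, ← summable_condensed_iff_of_nonneg]
  · refine summable_congr fun i => ?_
    have h2 : (1 : ℝ) ≤ 2 ^ (p * i) := one_le_pow₀ (by norm_num)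
    have := (hfpos _ h2).ne'
    push_cast
    rw [if_neg (by positivity), ← pow_mul, mul_comm i p]
    field_simp
  · intro n
    split_ifs with hn
    · exact le_rfl
    · have h2 : (1 : ℝ) ≤ (n : ℝ) ^ p := one_le_pow₀ (by exact_mod_cast Nat.one_le_iff_ne_zero.2 hn)
      have := hfpos _ h2
      positivity
  · intro m n hm hmn
    have h0 : (1 : ℝ) ≤ (m : ℝ) := by exact_mod_cast hm
    have h01 : (m : ℝ) ≤ n := by exact_mod_cast hmn
    have h2 : (1 : ℝ) ≤ (m : ℝ) ^ p := one_le_pow₀ h0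
    have h3 : (m : ℝ) ^ p ≤ (n : ℝ) ^ p := pow_le_pow_left₀ (by linarith) h01 p
    rw [if_neg (by omega), if_neg (by omega)]
    apply one_div_le_one_div_of_le (mul_pos (by linarith) (hfpos _ h2))
    exact mul_le_mul h01 (hfmono h2 (h2.trans h3) h3) (hfpos _ h2).le (by linarith)

theorem summable_of_logIntegral (h : logIntegral f < ∞) :
    Summable fun m : ℕ => 1 / (((m : ℝ) + 1) * f ((m : ℝ) + 1)) := by
  have := (summable_one_div_mul_pow_iff hfpos hfmono 1).2
    (by simpa using summable_of_logIntegral_lt_top hfpos hfmono h)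
  simpa using this

theorem not_summable_of_logIntegral (h : logIntegral f = ∞) {p : ℕ} (hp : p ≠ 0) :
    ¬ Summable fun m : ℕ => 1 / (((m : ℝ) + 1) * f (((m : ℝ) + 1) ^ p)) := by
  rw [summable_one_div_mul_pow_iff hfpos hfmono]
  intro hs
  refine (logIntegral_lt_top_of_summable hfpos hfmono ?_).ne h
  have hanti := inv_antitone_two_pow hfpos hfmono
  have hnn : ∀ i : ℕ, 0 ≤ 1 / f (2 ^ i) := fun i =>
    (one_div_pos.2 (hfpos _ (one_le_pow₀ (by norm_num)))).le
  -- The terms decrease, so each block of `p` consecutive ones is at most `p` times its first. Hence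
  -- divergence persists along multiples of `p`.
  have hblock : ∀ N, ∑ i ∈ Finset.range (p * N), 1 / f (2 ^ i) ≤
      p * ∑ i ∈ Finset.range N, 1 / f (2 ^ (p * i)) := by
    intro N
    induction N with
    | zero => simp
    | succ N ih =>
      rw [Nat.mul_succ, Finset.sum_range_add, Finset.sum_range_succ, mul_add]
      refine add_le_add ih ?_
      calc _ ≤ ∑ i ∈ Finset.range p, 1 / f (2 ^ (p * N)) :=
            Finset.sum_le_sum fun i _ => hanti (Nat.le_add_right _ _)
        _ = _ := by simp
  refine summable_of_sum_range_le (c := p * ∑' i : ℕ, 1 / f (2 ^ (p * i))) hnn fun N => ?_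
  calc ∑ i ∈ Finset.range N, 1 / f (2 ^ i) ≤ ∑ i ∈ Finset.range (p * N), 1 / f (2 ^ i) :=
        Finset.sum_le_sum_of_subset_of_nonneg (Finset.range_mono
          (Nat.le_mul_of_pos_left _ (Nat.pos_of_ne_zero hp))) fun i _ _ => hnn i
    _ ≤ _ := hblock N
    _ ≤ _ := by
      gcongr
      exact hs.sum_le_tsum _ fun i _ => hnn _

/-- A summable nonincreasing sequence u satisfies i u_i → 0, because the half block from i/2 to i
has vanishing sum. Apply this to u_i = 1/f(2^i) with i the binary logarithm of n. -/
theorem tendsto_log_div_of_logIntegral (h : logIntegral f < ∞) :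
    Tendsto (fun n : ℕ => Real.log n / f n) atTop (𝓝 0) := by
  set u : ℕ → ℝ := fun i => 1 / f (2 ^ i) with hu
  have hs : Summable u := summable_of_logIntegral_lt_top hfpos hfmono h
  have hanti : Antitone u := inv_antitone_two_pow hfpos hfmono
  have hnn : ∀ i : ℕ, 0 ≤ u i := fun i =>
    (one_div_pos.2 (hfpos _ (one_le_pow₀ (by norm_num)))).le
  have hsum := hs.hasSum.tendsto_sum_nat
  have hhalf : Tendsto (fun i : ℕ => i / 2) atTop atTop := Nat.tendsto_div_const_atTop (by norm_num)
  have hdiff := hsum.sub (hsum.comp hhalf)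
  rw [sub_self] at hdiff
  have hiu : Tendsto (fun i : ℕ => (i : ℝ) * u i) atTop (𝓝 0) := by
    have h2 := hdiff.const_mul 2
    rw [mul_zero] at h2
    refine squeeze_zero (fun i => mul_nonneg (Nat.cast_nonneg _) (hnn i)) (fun i => ?_) h2
    have h1 : ∑ j ∈ Finset.Ico (i / 2) i, u i ≤ ∑ j ∈ Finset.Ico (i / 2) i, u j :=
      Finset.sum_le_sum fun j hj => hanti (Finset.mem_Ico.1 hj).2.le
    rw [Finset.sum_const, Nat.card_Ico, nsmul_eq_mul,
      Finset.sum_Ico_eq_sub _ (Nat.div_le_self i 2)] at h1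
    have h3 : (i : ℝ) ≤ 2 * ((i - i / 2 : ℕ) : ℝ) := by
      have : i ≤ 2 * (i - i / 2) := by omega
      exact_mod_cast this
    simp only [Function.comp]
    nlinarith [hnn i]
  have hu0 : Tendsto u atTop (𝓝 0) := hs.tendsto_atTop_zero
  have hbd : Tendsto (fun i : ℕ => Real.log 2 * ((i : ℝ) * u i + u i)) atTop (𝓝 0) := by
    simpa using (hiu.add hu0).const_mul (Real.log 2)
  have hlog : Tendsto (fun n : ℕ => Nat.log 2 n) atTop atTop :=
    tendsto_atTop_atTop.2 fun b => ⟨2 ^ b, fun n hn => Nat.le_log_of_pow_le (by norm_num) hn⟩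
  refine squeeze_zero' ?_ ?_ (hbd.comp hlog)
  · filter_upwards [eventually_ge_atTop 1] with n hn
    have h1 : (1 : ℝ) ≤ n := by exact_mod_cast hn
    exact div_nonneg (Real.log_nonneg h1) (hfpos _ h1).le
  · filter_upwards [eventually_ge_atTop 1] with n hn
    have h1 : (1 : ℝ) ≤ n := by exact_mod_cast hn
    have h2 : (1 : ℝ) ≤ 2 ^ Nat.log 2 n := one_le_pow₀ (by norm_num)
    have h3 : (2 : ℝ) ^ Nat.log 2 n ≤ n := by exact_mod_cast Nat.pow_log_le_self 2 (by omega)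
    have h4 : (n : ℝ) ≤ 2 ^ (Nat.log 2 n + 1) := by
      exact_mod_cast (Nat.lt_pow_succ_log_self (by norm_num) n).le
    have h5 : Real.log n ≤ (Nat.log 2 n + 1) * Real.log 2 := by
      have := Real.log_le_log (by linarith) h4
      rwa [Real.log_pow, Nat.cast_add, Nat.cast_one] at this
    have h6 : f (2 ^ Nat.log 2 n) ≤ f n := hfmono h2 h1 h3
    have h7 := hfpos _ h2
    simp only [Function.comp]
    calc Real.log n / f n ≤ ((Nat.log 2 n + 1) * Real.log 2) / f (2 ^ Nat.log 2 n) :=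
          div_le_div₀ (mul_nonneg (by positivity) (Real.log_nonneg (by norm_num))) h5 h7 h6
      _ = _ := by simp only [hu]; ring

end LogIntegral

/-! ### Truncated moments from tail bounds -/

/-- Truncation of a real number to `[-a, a]`. -/
def clamp (a x : ℝ) : ℝ := max (-a) (min a x)

theorem measurable_clamp (a : ℝ) : Measurable (clamp a) := by
  unfold clamp; fun_prop

theorem abs_clamp {a : ℝ} (ha : 0 ≤ a) (x : ℝ) : |clamp a x| = min |x| a := by
  unfold clamp
  rcases le_total x 0 with hx | hx
  · rw [min_eq_right (hx.trans ha), abs_of_nonpos (max_le (by linarith) hx), abs_of_nonpos hx]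
    rcases le_total (-a) x with h | h
    · rw [max_eq_right h, min_eq_left (by linarith)]
    · rw [max_eq_left h, min_eq_right (by linarith), neg_neg]
  · rw [max_eq_right ((neg_nonpos.2 ha).trans (le_min ha hx)), abs_of_nonneg (le_min ha hx),
      abs_of_nonneg hx, min_comm]

theorem clamp_of_abs_le {a x : ℝ} (h : |x| ≤ a) : clamp a x = x := by
  unfold clamp
  rw [min_eq_right (abs_le.1 h).2, max_eq_right (abs_le.1 h).1]

theorem abs_clamp_sub {a : ℝ} (ha : 0 ≤ a) (x : ℝ) : |clamp a x - x| = max (|x| - a) 0 := by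
  rcases le_total |x| a with h | h
  · rw [clamp_of_abs_le h, sub_self, abs_zero, max_eq_right (by linarith)]
  · rw [max_eq_left (by linarith)]
    unfold clamp
    rcases le_total x 0 with hx | hx
    · rw [abs_of_nonpos hx] at h ⊢
      rw [min_eq_right (by linarith), max_eq_left (by linarith), abs_of_nonneg (by linarith)]
      ring
    · rw [abs_of_nonneg hx] at h ⊢
      rw [min_eq_left h, max_eq_right (by linarith), abs_of_nonpos (by linarith)]
      ring

theorem integrable_clamp (G : Measure ℝ) [IsProbabilityMeasure G] {a : ℝ} (ha : 0 ≤ a) :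
    Integrable (clamp a) G :=
  Integrable.of_bound (measurable_clamp a).aestronglyMeasurable a
    (Eventually.of_forall fun x => by
      rw [Real.norm_eq_abs, abs_clamp ha]; exact min_le_right _ _)

/-- Layer cake bound. -/
theorem integral_le_of_tail_le (G : Measure ℝ) [IsProbabilityMeasure G] {h φ : ℝ → ℝ} {S : Set ℝ}
    (hS : MeasurableSet S) (hh : Measurable h) (h0 : ∀ x, 0 ≤ h x)
    (hφ : IntegrableOn φ S) (hφ0 : ∀ t ∈ S, 0 ≤ φ t)
    (ht : ∀ t, 0 < t → G.real {x | t < h x} ≤ S.indicator φ t) :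
    Integrable h G ∧ ∫ x, h x ∂G ≤ ∫ t in S, φ t := by
  have key : ∫⁻ x, ENNReal.ofReal (h x) ∂G ≤ ENNReal.ofReal (∫ t in S, φ t) := by
    rw [lintegral_eq_lintegral_meas_lt G (Eventually.of_forall h0) hh.aemeasurable,
      ofReal_integral_eq_lintegral_ofReal hφ ((ae_restrict_iff' hS).2 (Eventually.of_forall hφ0)),
      ← lintegral_indicator hS]
    refine (setLIntegral_mono' (g := S.indicator fun t => ENNReal.ofReal (φ t)) measurableSet_Ioi
      fun t ht0 => ?_).trans (setLIntegral_le_lintegral _ _)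
    have h1 := ht t ht0
    rw [← ofReal_measureReal]
    refine (ENNReal.ofReal_le_ofReal h1).trans ?_
    by_cases hts : t ∈ S <;> simp [hts]
  have hint : Integrable h G := by
    refine ⟨hh.aestronglyMeasurable, ?_⟩
    rw [hasFiniteIntegral_iff_ofReal (Eventually.of_forall h0)]
    exact key.trans_lt ENNReal.ofReal_lt_top
  refine ⟨hint, ?_⟩
  rw [integral_eq_lintegral_of_nonneg_ae (Eventually.of_forall h0) hint.1]
  refine ENNReal.toReal_le_of_le_ofReal ?_ key
  exact setIntegral_nonneg hS hφ0

theorem integral_min_le_of_tail_le (G : Measure ℝ) [IsProbabilityMeasure G] {h φ : ℝ → ℝ} {a : ℝ}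
    (ha : 0 < a) (hh : Measurable h) (h0 : ∀ x, 0 ≤ h x)
    (hφ : IntervalIntegrable φ volume 0 a) (hφ0 : ∀ t, 0 < t → 0 ≤ φ t)
    (ht : ∀ t, 0 < t → G.real {x | t < h x} ≤ φ t) :
    ∫ x, min (h x) a ∂G ≤ ∫ t in 0..a, φ t := by
  rw [intervalIntegral.integral_of_le ha.le]
  refine (integral_le_of_tail_le G measurableSet_Ioc (hh.min measurable_const)
    (fun x => le_min (h0 x) ha.le) hφ.1 (fun t ht => hφ0 t ht.1) fun t ht0 => ?_).2
  by_cases hta : t ≤ a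
  · rw [Set.indicator_of_mem (show t ∈ Set.Ioc 0 a from ⟨ht0, hta⟩)]
    refine le_trans (measureReal_mono fun x hx => ?_) (ht t ht0)
    simp only [Set.mem_ofPred_eq, lt_min_iff] at hx ⊢
    exact hx.1
  · rw [Set.indicator_of_notMem fun h => hta h.2]
    have : {x | t < min (h x) a} = ∅ := by
      ext x
      simp only [Set.mem_ofPred_eq, Set.mem_empty_iff_false, iff_false, not_lt]
      exact (min_le_right _ _).trans (not_le.1 hta).le
    rw [this, measureReal_empty]

/-- Bounds on the tail, the truncated second moment and the truncated mean of a law whose tail is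
of order `x ^ (-α)`. -/
structure TruncationBounds (G : Measure ℝ) (α K : ℝ) : Prop where
  tail : ∀ a, 0 < a → G.real {x | a < |x|} ≤ K * a ^ (-α)
  sq : ∀ a, 0 < a → ∫ x, (clamp a x) ^ 2 ∂G ≤ K * a ^ (2 - α)
  mean : α ≠ 1 → ∀ a, 0 < a → |∫ x, clamp a x ∂G| ≤ K * a ^ (1 - α)
  mean_one : α = 1 → ∀ a, 0 < a → |∫ x, clamp a x ∂G| ≤ K * Real.log (1 + a)

section Tails
variable {G : Measure ℝ} [IsProbabilityMeasure G] {α K : ℝ}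
  (hK : 0 ≤ K) (htail : ∀ a, 0 < a → G.real {x | a < |x|} ≤ K * a ^ (-α))
include hK htail

/-- The squared truncation is min(x², a²), and its level-t tail is at most K t^(-α/2), which is
integrable at 0 because α < 2. -/
theorem integral_clamp_sq_le (hα₂ : α < 2) {a : ℝ} (ha : 0 < a) :
    ∫ x, (clamp a x) ^ 2 ∂G ≤ 2 * K / (2 - α) * a ^ (2 - α) := by
  have h1 : ∀ x, (clamp a x) ^ 2 = min (x ^ 2) (a ^ 2) := by
    intro x
    rw [← sq_abs, abs_clamp ha.le]
    rcases le_total |x| a with h | h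
    · rw [min_eq_left h, sq_abs, min_eq_left (sq_le_sq' (abs_le.1 h).1 (abs_le.1 h).2)]
    · rw [min_eq_right h, min_eq_right]
      rw [← sq_abs x]
      exact pow_le_pow_left₀ ha.le h 2
  simp_rw [h1]
  have hr : -1 < -α / 2 := by linarith
  refine (integral_min_le_of_tail_le G (φ := fun t => K * t ^ (-α / 2)) (by positivity)
    (by fun_prop) (fun x => sq_nonneg x)
    ((intervalIntegral.intervalIntegrable_rpow' hr).const_mul K)
    (fun t ht => by positivity) fun t ht => ?_).trans_eq ?_
  · have h2 := htail (Real.sqrt t) (Real.sqrt_pos.2 ht)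
    rw [Real.sqrt_eq_rpow, ← Real.rpow_mul ht.le] at h2
    rw [show -α / 2 = 1 / 2 * -α by ring]
    refine le_trans (measureReal_mono fun x hx => ?_) h2
    simp only [Set.mem_ofPred_eq] at hx ⊢
    rw [← Real.sqrt_eq_rpow, ← Real.sqrt_sq_eq_abs]
    exact Real.sqrt_lt_sqrt ht.le hx
  · rw [intervalIntegral.integral_const_mul, integral_rpow (Or.inl hr),
      Real.zero_rpow (by linarith), ← Real.rpow_natCast, ← Real.rpow_mul ha.le]
    have h3 : (2 : ℝ) - α ≠ 0 := by linarith
    have h4 : -α / 2 + 1 ≠ 0 := by linarith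
    rw [show ((2 : ℕ) : ℝ) * (-α / 2 + 1) = 2 - α by push_cast; ring]
    rw [show -α / 2 + 1 = (2 - α) / 2 by ring, sub_zero]
    field_simp

theorem abs_integral_clamp_le_of_lt_one (hα₁ : α < 1) {a : ℝ} (ha : 0 < a) :
    |∫ x, clamp a x ∂G| ≤ K / (1 - α) * a ^ (1 - α) := by
  refine (abs_integral_le_integral_abs).trans ?_
  simp_rw [abs_clamp ha.le]
  have hr : -1 < -α := by linarith
  refine (integral_min_le_of_tail_le G (φ := fun t => K * t ^ (-α)) ha
    (by fun_prop) (fun x => abs_nonneg x)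
    ((intervalIntegral.intervalIntegrable_rpow' hr).const_mul K)
    (fun t ht => by positivity) htail).trans_eq ?_
  rw [intervalIntegral.integral_const_mul, integral_rpow (Or.inl hr),
      Real.zero_rpow (by linarith), show -α + 1 = 1 - α by ring]
  ring

/-- The bound K/t is not integrable at 0; combined with the trivial bound 1 it becomes (K + 1)/(t +
1), whence the logarithm. -/
theorem abs_integral_clamp_le_of_eq_one (hα₁ : α = 1) {a : ℝ} (ha : 0 < a) :
    |∫ x, clamp a x ∂G| ≤ (K + 1) * Real.log (1 + a) := by
  refine (abs_integral_le_integral_abs).trans ?_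
  simp_rw [abs_clamp ha.le]
  have hcont : ContinuousOn (fun t : ℝ => (K + 1) * (t + 1)⁻¹) (Set.uIcc 0 a) := by
    rw [Set.uIcc_of_le ha.le]
    refine continuousOn_const.mul (ContinuousOn.inv₀ (by fun_prop) fun x hx => ?_)
    have := hx.1
    positivity
  refine (integral_min_le_of_tail_le G (φ := fun t => (K + 1) * (t + 1)⁻¹) ha
    (by fun_prop) (fun x => abs_nonneg x) hcont.intervalIntegrable
    (fun t ht => by positivity) fun t ht => ?_).trans_eq ?_
  · have h1 := htail t ht
    rw [hα₁, Real.rpow_neg_one] at h1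
    have h2 : G.real {x | t < |x|} ≤ 1 := measureReal_le_one
    set g := G.real {x | t < |x|}
    have h3 : g * t ≤ K := by
      have := mul_le_mul_of_nonneg_right h1 ht.le
      rwa [mul_assoc, inv_mul_cancel₀ ht.ne', mul_one] at this
    rw [← div_eq_mul_inv, le_div_iff₀ (by positivity)]
    linarith
  · rw [intervalIntegral.integral_const_mul,
      intervalIntegral.integral_comp_add_right (fun x => x⁻¹), integral_inv_of_pos (by norm_num)
      (by positivity)]
    simp [add_comm]

theorem integrable_max_sub_of_one_lt (hα₁ : 1 < α) {a : ℝ} (ha : 0 < a) :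
    Integrable (fun x => max (|x| - a) 0) G ∧
      ∫ x, max (|x| - a) 0 ∂G ≤ K / (α - 1) * a ^ (1 - α) := by
  have hd : ∀ t ∈ Set.Ici (0 : ℝ), HasDerivAt (fun t => -(K / (α - 1)) * (t + a) ^ (1 - α))
      (K * (t + a) ^ (-α)) t := by
    intro t ht
    have hta : t + a ≠ 0 := by have : (0 : ℝ) ≤ t := ht; positivity
    have h1 := (((hasDerivAt_id' t).add_const a).rpow_const (p := 1 - α) (Or.inl hta)).const_mul
      (-(K / (α - 1)))
    refine h1.congr_deriv ?_
    have : α - 1 ≠ 0 := by linarith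
    rw [show 1 - α - 1 = -α by ring]
    field_simp
    ring
  have htend : Tendsto (fun t : ℝ => -(K / (α - 1)) * (t + a) ^ (1 - α)) atTop (𝓝 0) := by
    have h1 : Tendsto (fun t : ℝ => (t + a) ^ (-(α - 1))) atTop (𝓝 0) :=
      (tendsto_rpow_neg_atTop (by linarith)).comp (tendsto_atTop_add_const_right _ _ tendsto_id)
    have := h1.const_mul (-(K / (α - 1)))
    simpa [neg_sub] using this
  have hnn : ∀ t ∈ Set.Ioi (0 : ℝ), 0 ≤ K * (t + a) ^ (-α) := fun t ht => by
    have : (0 : ℝ) < t := ht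
    positivity
  have hint := integrableOn_Ioi_deriv_of_nonneg' hd hnn htend
  have hval := integral_Ioi_of_hasDerivAt_of_tendsto' hd hint htend
  have := integral_le_of_tail_le G (h := fun x => max (|x| - a) 0)
    (φ := fun t => K * (t + a) ^ (-α)) measurableSet_Ioi (by fun_prop) (fun x => le_max_right _ _)
    hint hnn fun t ht => ?_
  · refine ⟨this.1, this.2.trans_eq ?_⟩
    rw [hval]
    simp
  · rw [Set.indicator_of_mem (show t ∈ Set.Ioi 0 from ht)]
    refine le_trans (measureReal_mono fun x hx => ?_) (htail (t + a) (by positivity))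
    simp only [Set.mem_ofPred_eq, lt_max_iff] at hx ⊢
    rcases hx with h | h <;> linarith

theorem integrable_id_of_one_lt (hα₁ : 1 < α) : Integrable (fun x : ℝ => x) G := by
  have h1 := ((integrable_max_sub_of_one_lt hK htail hα₁ one_pos).1).add (integrable_const (1 : ℝ))
  refine h1.mono (by fun_prop) (Eventually.of_forall fun x => ?_)
  simp only [Pi.add_apply, Real.norm_eq_abs]
  refine le_trans ?_ (le_abs_self _)
  linarith [le_max_left (|x| - 1) 0]

/-- Since the mean vanishes, the truncated mean equals that of the truncation error, whose modulus
is the overshoot (|x| - a)⁺. -/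
theorem abs_integral_clamp_le_of_one_lt (hα₁ : 1 < α) (hmean : ∫ x, x ∂G = 0) {a : ℝ}
    (ha : 0 < a) : |∫ x, clamp a x ∂G| ≤ K / (α - 1) * a ^ (1 - α) := by
  have h1 : ∫ x, clamp a x ∂G = ∫ x, (clamp a x - x) ∂G := by
    rw [integral_sub (integrable_clamp G ha.le) (integrable_id_of_one_lt hK htail hα₁), hmean,
      sub_zero]
  rw [h1]
  refine (abs_integral_le_integral_abs).trans ?_
  simp_rw [abs_clamp_sub ha.le]
  exact (integrable_max_sub_of_one_lt hK htail hα₁ ha).2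

theorem exists_truncationBounds (hα₂ : α < 2) (hmean : 1 < α → ∫ x, x ∂G = 0) :
    ∃ C, 0 ≤ C ∧ TruncationBounds G α C := by
  set C := K + 2 * K / (2 - α) + K / |1 - α| + (K + 1) with hC
  have h2 : 0 < 2 - α := by linarith
  have p2 : 0 ≤ 2 * K / (2 - α) := by positivity
  have p3 : 0 ≤ K / |1 - α| := by positivity
  refine ⟨C, by positivity, ⟨fun a ha => ?_, fun a ha => ?_, fun h1 a ha => ?_, fun h1 a ha => ?_⟩⟩
  · refine (htail a ha).trans (mul_le_mul_of_nonneg_right ?_ (by positivity))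
    linarith
  · refine (integral_clamp_sq_le hK htail hα₂ ha).trans
      (mul_le_mul_of_nonneg_right ?_ (by positivity))
    linarith
  · rcases lt_or_gt_of_ne h1 with h | h
    · refine (abs_integral_clamp_le_of_lt_one hK htail h ha).trans
        (mul_le_mul_of_nonneg_right ?_ (by positivity))
      rw [abs_of_pos (by linarith)] at hC p3
      linarith
    · refine (abs_integral_clamp_le_of_one_lt hK htail h (hmean h) ha).trans
        (mul_le_mul_of_nonneg_right ?_ (by positivity))
      rw [abs_of_neg (by linarith), neg_sub] at hC p3
      linarith
  · refine (abs_integral_clamp_le_of_eq_one hK htail h1 ha).trans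
        (mul_le_mul_of_nonneg_right ?_ (Real.log_nonneg (by linarith)))
    linarith

end Tails

/-! ### Almost sure convergence of truncated series -/

section Series
variable {Ω : Type*} [MeasurableSpace Ω] {P : Measure Ω} [IsProbabilityMeasure P]

/-- **Kolmogorov's one-series theorem**: a series of centered independent variables whose
variances are summable converges almost surely. -/
theorem ae_exists_tendsto_sum_of_summable_sq {Y : ℕ → Ω → ℝ} (hYm : ∀ k, Measurable (Y k))
    (hYind : iIndepFun Y P) (hY2 : ∀ k, MemLp (Y k) 2 P) (hY0 : ∀ k, ∫ ω, Y k ω ∂P = 0)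
    (hsum : Summable fun k => ∫ ω, (Y k ω) ^ 2 ∂P) :
    ∀ᵐ ω ∂P, ∃ c, Tendsto (fun n => ∑ k ∈ Finset.range n, Y k ω) atTop (𝓝 c) := by
  have hsm : ∀ k, StronglyMeasurable (Y k) := fun k => (hYm k).stronglyMeasurable
  set ℱ := Filtration.natural Y hsm with hℱ
  -- The sum includes index `n`, so `M` is adapted to the natural filtration. It is a martingale
  -- bounded in L², hence in L¹ by |x| ≤ 1 + x².
  set M : ℕ → Ω → ℝ := fun n => ∑ k ∈ Finset.range (n + 1), Y k with hM
  have hint : ∀ k, Integrable (Y k) P := fun k => (hY2 k).integrable one_le_two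
  have hML : ∀ n, MemLp (M n) 2 P := fun n => memLp_finsetSum' _ fun k _ => hY2 k
  have hmart : Martingale M ℱ P := by
    refine martingale_of_condExp_sub_eq_zero_nat (fun n => ?_)
      (fun n => (hML n).integrable one_le_two) fun n => ?_
    · refine Finset.stronglyMeasurable_sum _ fun k hk => ?_
      exact (Filtration.stronglyAdapted_natural hsm k).mono
        (ℱ.mono (Nat.lt_succ_iff.1 (Finset.mem_range.1 hk)))
    · have h1 : M (n + 1) - M n = Y (n + 1) := by
        simp only [hM]
        rw [Finset.sum_range_succ _ (n + 1)]
        simp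
      rw [h1]
      refine (hYind.condExp_natural_ae_eq_of_lt hsm (Nat.lt_succ_self n)).trans ?_
      rw [hY0]
      rfl
  have hsq : ∀ n, ∫ ω, (M n ω) ^ 2 ∂P ≤ ∑' k, ∫ ω, (Y k ω) ^ 2 ∂P := by
    intro n
    have h0 : ∫ ω, M n ω ∂P = 0 := by
      simp only [hM, Finset.sum_apply]
      rw [integral_finsetSum _ fun k _ => hint k]
      simp [hY0]
    have hv : ∀ {Z : Ω → ℝ}, MemLp Z 2 P → ∫ ω, Z ω ∂P = 0 →
        variance Z P = ∫ ω, (Z ω) ^ 2 ∂P := by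
      intro Z hZ hZ0
      rw [variance_of_integral_eq_zero hZ.aemeasurable hZ0]
    rw [← hv (hML n) h0, IndepFun.variance_sum (fun k _ => hY2 k)
      fun i _ j _ hij => hYind.indepFun hij]
    simp_rw [fun k => hv (hY2 k) (hY0 k)]
    exact hsum.sum_le_tsum _ fun k _ => integral_nonneg fun ω => sq_nonneg _
  have hbdd : ∀ n, eLpNorm (M n) 1 P ≤
      ((1 + ∑' k, ∫ ω, (Y k ω) ^ 2 ∂P).toNNReal : ℝ≥0∞) := by
    intro n
    rw [eLpNorm_one_eq_lintegral_enorm, ← ofReal_integral_norm_eq_lintegral_enorm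
      ((hML n).integrable one_le_two)]
    refine ENNReal.ofReal_le_ofReal ?_
    calc ∫ ω, ‖M n ω‖ ∂P ≤ ∫ ω, (1 + (M n ω) ^ 2) ∂P := by
          refine integral_mono ((hML n).integrable one_le_two).norm
            ((integrable_const _).add (hML n).integrable_sq) fun ω => ?_
          simp only [Real.norm_eq_abs]
          nlinarith [sq_nonneg (|M n ω| - 1), sq_abs (M n ω), abs_nonneg (M n ω)]
      _ = 1 + ∫ ω, (M n ω) ^ 2 ∂P := by
          rw [integral_add (integrable_const _) (hML n).integrable_sq]; simp
      _ ≤ _ := by linarith [hsq n]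
  filter_upwards [hmart.submartingale.exists_ae_tendsto_of_bdd hbdd] with ω ⟨c, hc⟩
  refine ⟨c, (tendsto_add_atTop_iff_nat 1).1 ?_⟩
  simpa [hM] using hc

/-- Strong law for the truncatable summands of one type, with norming constants `w`. -/
theorem ae_tendsto_sum_ite_div {X : ℕ → Ω → ℝ} (hXm : ∀ k, Measurable (X k))
    (hXind : iIndepFun X P) {T : ℕ → Prop} [DecidablePred T] {G : Measure ℝ}
    [IsProbabilityMeasure G] (hlaw : ∀ k, T k → P.map (X k) = G) {α K : ℝ} (hK : 0 ≤ K)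
    (hG : TruncationBounds G α K) {w : ℕ → ℝ} (hw : Monotone w) (hpos : ∀ k, 0 < w k)
    (htop : Tendsto w atTop atTop) (hsum : Summable fun k => if T k then w k ^ (-α) else 0)
    (hone : α = 1 → Tendsto (fun n => (Nat.count T (n + 1) : ℝ) * Real.log (1 + w n) / w n)
      atTop (𝓝 0)) :
    ∀ᵐ ω ∂P, Tendsto (fun n => (∑ k ∈ Finset.range (n + 1), if T k then X k ω else 0) / w n)
      atTop (𝓝 0) := by
  set g : ℕ → ℝ → ℝ := fun k x => if T k then clamp (w k) x else 0 with hg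
  have hgm : ∀ k, Measurable (g k) := by
    intro k
    by_cases hk : T k
    · simpa [hg, hk] using measurable_clamp (w k)
    · simp [hg, hk]
  have hgb : ∀ k x, |g k x| ≤ w k := by
    intro k x
    by_cases hk : T k
    · simp only [hg, hk, if_true]
      rw [abs_clamp (hpos k).le]
      exact min_le_right _ _
    · simp [hg, hk, (hpos k).le]
  set m : ℕ → ℝ := fun k => ∫ ω, g k (X k ω) ∂P with hm
  have hZL : ∀ k, MemLp (fun ω => g k (X k ω)) 2 P := fun k =>
    MemLp.of_bound ((hgm k).comp (hXm k)).aestronglyMeasurable (w k)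
      (Eventually.of_forall fun ω => hgb k _)
  have htr : ∀ k, T k → ∀ h : ℝ → ℝ, Measurable h →
      ∫ ω, h (X k ω) ∂P = ∫ x, h x ∂G := by
    intro k hk h hh
    rw [← hlaw k hk, integral_map (hXm k).aemeasurable hh.aestronglyMeasurable]
  -- the centered and truncated series
  set y : ℕ → ℝ → ℝ := fun k x => (g k x - m k) / w k with hy
  have hym : ∀ k, Measurable (y k) := fun k => ((hgm k).sub_const _).div_const _
  have hA : ∀ᵐ ω ∂P, ∃ c, Tendsto (fun n => ∑ k ∈ Finset.range n, (g k (X k ω) - m k) / w k)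
      atTop (𝓝 c) := by
    refine ae_exists_tendsto_sum_of_summable_sq (Y := fun k ω => y k (X k ω))
      (fun k => (hym k).comp (hXm k)) (hXind.comp y hym) (fun k => ?_) (fun k => ?_) ?_
    · have := ((hZL k).sub (memLp_const (m k))).const_mul (w k)⁻¹
      refine this.ae_eq (Eventually.of_forall fun ω => ?_)
      simp only [hy, Pi.sub_apply]
      rw [div_eq_inv_mul]
    · simp only [hy]
      rw [integral_div, integral_sub ((hZL k).integrable one_le_two) (integrable_const _)]
      simp [hm]
    -- Division by w_k² turns the truncated second moment bound K w_k^(2-α) into K times the summand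
    -- of `hsum`.
    · refine Summable.of_nonneg_of_le (fun k => integral_nonneg fun ω => sq_nonneg _)
        (fun k => ?_) (hsum.mul_left K)
      have h1 : ∫ ω, (y k (X k ω)) ^ 2 ∂P = variance (fun ω => g k (X k ω)) P / (w k) ^ 2 := by
        rw [variance_eq_integral (hZL k).aemeasurable, ← integral_div]
        simp only [hy, div_pow, hm]
      have h2 : variance (fun ω => g k (X k ω)) P ≤ ∫ ω, (g k (X k ω)) ^ 2 ∂P :=
        variance_le_expectation_sq (hZL k).aestronglyMeasurable
      have hwk := hpos k
      by_cases hk : T k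
      · rw [htr k hk _ ((hgm k).pow_const 2)] at h2
        simp only [hg, hk, if_true] at h2
        have h3 := h2.trans (hG.sq (w k) hwk)
        rw [h1, if_pos hk, div_le_iff₀ (by positivity), mul_assoc, ← Real.rpow_natCast (w k) 2,
          ← Real.rpow_add hwk]
        rw [show (-α + ((2 : ℕ) : ℝ)) = 2 - α by push_cast; ring]
        simpa [hg, hk] using h3
      · have h4 : variance (fun ω => g k (X k ω)) P ≤ 0 := by simpa [hg, hk] using h2
        rw [h1, if_neg hk, mul_zero]
        exact div_nonpos_of_nonpos_of_nonneg h4 (sq_nonneg _)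
  -- the means
  have hmean : Tendsto (fun n => (∑ k ∈ Finset.range (n + 1), m k) / w n) atTop (𝓝 0) := by
    have hm0 : ∀ k, ¬ T k → m k = 0 := fun k hk => by simp [hm, hg, hk]
    have hmT : ∀ k, T k → m k = ∫ x, clamp (w k) x ∂G := fun k hk => by
      have := htr k hk (g k) (hgm k)
      simpa [hm, hg, hk] using this
    -- For α ≠ 1 the means divided by w_k are dominated by w_k^(-α), and Kronecker applies. For α =
    -- 1 the logarithmic bound is too weak for that, and the sum is estimated by the count times the
    -- largest bound.
    by_cases hα : α = 1
    · have h1 := (hone hα).const_mul K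
      rw [mul_zero] at h1
      refine squeeze_zero_norm (fun n => ?_) h1
      rw [norm_div, Real.norm_of_nonneg (hpos n).le, ← mul_div_assoc]
      refine div_le_div_of_nonneg_right ?_ (hpos n).le
      calc ‖∑ k ∈ Finset.range (n + 1), m k‖
          ≤ ∑ k ∈ Finset.range (n + 1), if T k then K * Real.log (1 + w n) else 0 := by
            refine norm_sum_le_of_le _ fun k hk => ?_
            by_cases hk' : T k
            · rw [if_pos hk', hmT k hk']
              refine (hG.mean_one hα _ (hpos k)).trans (mul_le_mul_of_nonneg_left ?_ hK)
              refine Real.log_le_log (by linarith [hpos k]) ?_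
              linarith [hw (Nat.lt_succ_iff.1 (Finset.mem_range.1 hk))]
            · simp [hk', hm0 k hk']
        _ = _ := by
            rw [← Finset.sum_filter, Finset.sum_const, nsmul_eq_mul,
              ← Nat.count_eq_card_filter_range]
            ring
    · have h1 : Summable fun k => m k / w k := by
        refine Summable.of_norm_bounded (hsum.mul_left K) fun k => ?_
        have hwk := hpos k
        by_cases hk : T k
        · rw [if_pos hk, norm_div, Real.norm_of_nonneg hwk.le, div_le_iff₀ hwk, hmT k hk]
          refine (hG.mean hα _ hwk).trans_eq ?_
          rw [mul_assoc]
          nth_rw 3 [← Real.rpow_one (w k)]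
          rw [← Real.rpow_add hwk, show -α + 1 = 1 - α by ring]
        · simp [hk, hm0 k hk]
      exact tendsto_sum_div_of_tendsto_sum_div hw hpos htop h1.hasSum.tendsto_sum_nat
  -- large values
  have hBC : ∀ᵐ ω ∂P, ∀ᶠ k in atTop, ω ∉ {ω | T k ∧ w k < |X k ω|} := by
    refine ae_eventually_notMem ?_
    have h1 : ∀ k, P {ω | T k ∧ w k < |X k ω|} ≤
        ENNReal.ofReal (K * if T k then w k ^ (-α) else 0) := by
      intro k
      by_cases hk : T k
      · simp only [hk, true_and, if_true]
        have h2 := hG.tail (w k) (hpos k)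
        rw [← hlaw k hk, map_measureReal_apply (hXm k)
          (measurableSet_lt measurable_const (by fun_prop))] at h2
        rw [← ofReal_measureReal]
        exact ENNReal.ofReal_le_ofReal h2
      · simp [hk]
    exact ne_top_of_le_ne_top (hsum.mul_left K).tsum_ofReal_ne_top (ENNReal.tsum_le_tsum h1)
  filter_upwards [hA, hBC] with ω ⟨c, hc⟩ hB
  have h1 := tendsto_sum_div_of_tendsto_sum_div hw hpos htop hc
  -- Only finitely many terms differ from zero, by Borel–Cantelli.
  have h2 : Summable fun k => ((if T k then X k ω else 0) - g k (X k ω)) / w k := by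
    obtain ⟨N, hN⟩ := eventually_atTop.1 hB
    rw [← summable_nat_add_iff N]
    refine summable_zero.congr fun k => ?_
    have h3 := hN (k + N) (Nat.le_add_left _ _)
    by_cases hk : T (k + N)
    · simp only [hk, true_and, not_lt] at h3
      simp [hg, hk, clamp_of_abs_le h3]
    · simp [hg, hk]
  have h3 := tendsto_sum_div_of_tendsto_sum_div hw hpos htop h2.hasSum.tendsto_sum_nat
  have h4 := (h1.add hmean).add h3
  simp only [add_zero] at h4
  refine h4.congr fun n => ?_
  rw [← add_div, ← add_div, ← Finset.sum_add_distrib, ← Finset.sum_add_distrib]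
  congr 1
  exact Finset.sum_congr rfl fun k _ => by ring

end Series

/-! ### Tightness and moduli of characteristic functions -/

theorem exists_measureReal_le_abs_lt (μ : Measure ℝ) [IsProbabilityMeasure μ] {ε : ℝ}
    (hε : 0 < ε) : ∃ M, 0 < M ∧ μ.real {x | M ≤ |x|} < ε := by
  have hanti : Antitone fun n : ℕ => {x : ℝ | (n : ℝ) ≤ |x|} := by
    intro i j hij x hx
    simp only [Set.mem_ofPred_eq] at hx ⊢
    exact (Nat.cast_le.2 hij).trans hx
  have h := tendsto_measure_iInter_atTop (μ := μ) (s := fun n : ℕ => {x : ℝ | (n : ℝ) ≤ |x|})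
    (fun n => (measurableSet_le measurable_const (by fun_prop)).nullMeasurableSet) hanti
    ⟨0, measure_ne_top _ _⟩
  have hempty : ⋂ n : ℕ, {x : ℝ | (n : ℝ) ≤ |x|} = ∅ := by
    ext x
    simp only [Set.mem_iInter, Set.mem_ofPred_eq, Set.mem_empty_iff_false, iff_false, not_forall,
      not_le]
    exact exists_nat_gt |x|
  rw [hempty, measure_empty] at h
  have h2 := (ENNReal.tendsto_toReal ENNReal.zero_ne_top).comp h
  rw [ENNReal.toReal_zero] at h2
  obtain ⟨n, hn1, hn2⟩ := ((h2.eventually_lt_const hε).and (eventually_ge_atTop 1)).exists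
  exact ⟨n, by exact_mod_cast hn2, hn1⟩

theorem exists_eventually_measureReal_le {Ω : ℕ → Type*} [∀ n, MeasurableSpace (Ω n)]
    {P : ∀ n, Measure (Ω n)} [∀ n, IsProbabilityMeasure (P n)] {Y : ∀ n, Ω n → ℝ} {L : Measure ℝ}
    [IsProbabilityMeasure L] (h : TendstoInDistribution Y atTop (id : ℝ → ℝ) P L) {ε : ℝ}
    (hε : 0 < ε) :
    ∃ M, 0 < M ∧ ∀ᶠ n in atTop, ((P n).map (Y n)).real {x | M ≤ |x|} < ε := by
  obtain ⟨M, hM, hLM⟩ := exists_measureReal_le_abs_lt L hε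
  refine ⟨M, hM, ?_⟩
  have hcl : IsClosed {x : ℝ | M ≤ |x|} := isClosed_le continuous_const continuous_abs
  have h1 := ProbabilityMeasure.limsup_measure_closed_le_of_tendsto h.tendsto hcl
  simp only [ProbabilityMeasure.coe_mk, Measure.map_id] at h1
  have h2 : L {x : ℝ | M ≤ |x|} < ENNReal.ofReal ε := by
    rw [← ofReal_measureReal]
    exact (ENNReal.ofReal_lt_ofReal_iff hε).2 hLM
  filter_upwards [eventually_lt_of_limsup_lt (h1.trans_lt h2)] with n hn
  rw [measureReal_def]
  exact (ENNReal.lt_ofReal_iff_toReal_lt hn.ne_top).1 hn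

/-- Bound |e^(itx) - 1| by |t| M where |x| < M and by 2 elsewhere; the outer factor 2 comes from 1 -
r² ≤ 2(1 - r). -/
theorem one_sub_norm_sq_charFun_le (μ : Measure ℝ) [IsProbabilityMeasure μ] {M t : ℝ}
    (hM : 0 < M) :
    1 - ‖charFun μ t‖ ^ 2 ≤ 2 * (|t| * M + 2 * μ.real {x | M ≤ |x|}) := by
  have hms : MeasurableSet {x : ℝ | M ≤ |x|} := measurableSet_le measurable_const (by fun_prop)
  have hint : Integrable (fun x : ℝ => Complex.exp (t * x * Complex.I)) μ :=
    Integrable.of_bound (by fun_prop) 1 (Eventually.of_forall fun x => by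
      rw [show (t : ℂ) * x * Complex.I = ((t * x : ℝ) : ℂ) * Complex.I by push_cast; ring,
        Complex.norm_exp_ofReal_mul_I])
  have h1 : ‖charFun μ t - 1‖ ≤ |t| * M + 2 * μ.real {x | M ≤ |x|} := by
    have h2 : charFun μ t - 1 = ∫ x, (Complex.exp (t * x * Complex.I) - 1) ∂μ := by
      rw [integral_sub hint (integrable_const _), charFun_apply_real]; simp
    rw [h2]
    refine (norm_integral_le_integral_norm _).trans ?_
    have h3 : ∀ x : ℝ, ‖Complex.exp (t * x * Complex.I) - 1‖ ≤
        |t| * M + {x : ℝ | M ≤ |x|}.indicator (fun _ => (2 : ℝ)) x := by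
      intro x
      have e1 : (t : ℂ) * x * Complex.I = ((t * x : ℝ) : ℂ) * Complex.I := by push_cast; ring
      rw [e1]
      by_cases hx : M ≤ |x|
      · rw [Set.indicator_of_mem (show x ∈ {x : ℝ | M ≤ |x|} from hx)]
        refine (norm_sub_le _ _).trans ?_
        rw [Complex.norm_exp_ofReal_mul_I, norm_one]
        have : 0 ≤ |t| * M := by positivity
        linarith
      · rw [Set.indicator_of_notMem (show x ∉ {x : ℝ | M ≤ |x|} from hx), add_zero, mul_comm]
        refine Real.norm_exp_I_mul_ofReal_sub_one_le.trans ?_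
        rw [Real.norm_eq_abs, abs_mul]
        exact mul_le_mul_of_nonneg_left (not_le.1 hx).le (abs_nonneg _)
    refine (integral_mono (hint.sub (integrable_const _)).norm
      ((integrable_const _).add ((integrable_const _).indicator hms)) h3).trans_eq ?_
    rw [integral_add' (integrable_const _) ((integrable_const _).indicator hms),
      integral_indicator_const _ hms]
    simp [mul_comm]
  have h4 : 1 - ‖charFun μ t‖ ≤ ‖charFun μ t - 1‖ := by
    have := norm_sub_norm_le (1 : ℂ) (charFun μ t)
    rwa [norm_one, norm_sub_rev] at this
  have h5 := norm_charFun_le_one (μ := μ) t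
  nlinarith [norm_nonneg (charFun μ t)]

/-- Equicontinuity at `0` of the characteristic functions of a weakly convergent sequence. -/
theorem exists_eventually_one_sub_norm_sq_le {Ω : ℕ → Type*} [∀ n, MeasurableSpace (Ω n)]
    {P : ∀ n, Measure (Ω n)} [∀ n, IsProbabilityMeasure (P n)] {Y : ∀ n, Ω n → ℝ} {L : Measure ℝ}
    [IsProbabilityMeasure L] (h : TendstoInDistribution Y atTop (id : ℝ → ℝ) P L) {ε : ℝ}
    (hε : 0 < ε) :
    ∃ δ, 0 < δ ∧ ∀ᶠ n in atTop, ∀ t, |t| ≤ δ → 1 - ‖charFun ((P n).map (Y n)) t‖ ^ 2 ≤ ε := by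
  obtain ⟨M, hM, hev⟩ := exists_eventually_measureReal_le h (show 0 < ε / 8 by positivity)
  refine ⟨ε / (4 * M), by positivity, hev.mono fun n hn t ht => ?_⟩
  have := Measure.isProbabilityMeasure_map (h.forall_aemeasurable n)
  refine (one_sub_norm_sq_charFun_le _ hM).trans ?_
  have h1 : |t| * M ≤ ε / 4 := by
    calc |t| * M ≤ ε / (4 * M) * M := by gcongr
      _ = ε / 4 := by field_simp
  linarith

theorem tendsto_norm_charFun {Ω : ℕ → Type*} [∀ n, MeasurableSpace (Ω n)]
    {P : ∀ n, Measure (Ω n)} [∀ n, IsProbabilityMeasure (P n)] {Y : ∀ n, Ω n → ℝ} {L : Measure ℝ}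
    [IsProbabilityMeasure L] (h : TendstoInDistribution Y atTop (id : ℝ → ℝ) P L) (t : ℝ) :
    Tendsto (fun n => ‖charFun ((P n).map (Y n)) t‖) atTop (𝓝 ‖charFun L t‖) := by
  have h1 := (ProbabilityMeasure.tendsto_iff_tendsto_charFun.1 h.tendsto t).norm
  simpa using h1

/-- Centering multiplies the characteristic function by a number of modulus 1, so taking moduli
removes it from all later estimates. -/
theorem norm_charFun_map_sum_sub_div {Ω : Type*} [MeasurableSpace Ω] {P : Measure Ω}
    [IsProbabilityMeasure P] {X : ℕ → Ω → ℝ} (hXm : ∀ k, Measurable (X k)) (hXind : iIndepFun X P)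
    (n : ℕ) (a b t : ℝ) :
    ‖charFun (P.map fun ω => ((∑ k ∈ Finset.range n, X k ω) - a) / b) t‖ =
      ∏ k ∈ Finset.range n, ‖charFun (P.map (X k)) (t / b)‖ := by
  have hSm : Measurable fun ω => ∑ k ∈ Finset.range n, X k ω := by fun_prop
  have h1 : (P.map fun ω => ((∑ k ∈ Finset.range n, X k ω) - a) / b) =
      ((P.map fun ω => ∑ k ∈ Finset.range n, X k ω).map (· + -a)).map (b⁻¹ * ·) := by
    rw [Measure.map_map (by fun_prop) (by fun_prop), Measure.map_map (by fun_prop) (by fun_prop)]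
    congr 1
    ext ω
    simp only [Function.comp]
    ring
  rw [h1, charFun_map_mul, charFun_map_add_const,
    iIndepFun.charFun_map_fun_finsetSum_eq_prod (fun k _ => (hXm k).aemeasurable)
      (hXind.restrict _), norm_mul, Complex.norm_exp_ofReal_mul_I, mul_one, Finset.prod_apply,
    norm_prod, inv_mul_eq_div]

/-! ### Symmetrization -/

/-- The law of `Z - Z'` for independent `Z`, `Z'` with law `G`. -/
noncomputable def symmetrization (G : Measure ℝ) : Measure ℝ := G.conv (G.map fun x => -x)

section Symm
variable (G : Measure ℝ) [IsProbabilityMeasure G]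

instance : IsProbabilityMeasure (G.map fun x => -x) :=
  Measure.isProbabilityMeasure_map (by fun_prop)

instance : IsProbabilityMeasure (symmetrization G) := by
  unfold symmetrization; infer_instance

theorem charFun_symmetrization (t : ℝ) :
    charFun (symmetrization G) t = ((‖charFun G t‖ ^ 2 : ℝ) : ℂ) := by
  have h1 : (fun x : ℝ => -x) = ((-1) * ·) := by ext; simp
  rw [symmetrization, charFun_conv, h1, charFun_map_mul, neg_one_mul, charFun_neg,
    Complex.mul_conj, Complex.normSq_eq_norm_sq]

theorem measureReal_symmetrization_le (a : ℝ) :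
    (symmetrization G).real {x | 2 * a < |x|} ≤ 2 * G.real {x | a < |x|} := by
  have hms : ∀ b : ℝ, MeasurableSet {x : ℝ | b < |x|} := fun b =>
    measurableSet_lt measurable_const (by fun_prop)
  have h1 : (symmetrization G).real {x | 2 * a < |x|} =
      (G.prod (G.map fun x => -x)).real {p : ℝ × ℝ | 2 * a < |p.1 + p.2|} := by
    rw [symmetrization, Measure.conv, map_measureReal_apply (by fun_prop) (hms _)]
    rfl
  have h2 : {p : ℝ × ℝ | 2 * a < |p.1 + p.2|} ⊆
      ({x | a < |x|} ×ˢ Set.univ) ∪ (Set.univ ×ˢ {x | a < |x|}) := by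
    rintro ⟨x, y⟩ hp
    simp only [Set.mem_union, Set.mem_prod, Set.mem_univ, and_true, true_and,
      Set.mem_ofPred_eq] at hp ⊢
    by_contra hcon
    push Not at hcon
    linarith [abs_add_le x y]
  have h3 : (G.map fun x => -x).real {x | a < |x|} = G.real {x | a < |x|} := by
    rw [map_measureReal_apply (by fun_prop) (hms _)]
    congr 1
    ext x
    simp
  rw [h1]
  refine (measureReal_mono h2).trans ((measureReal_union_le _ _).trans_eq ?_)
  rw [measureReal_prod_prod, measureReal_prod_prod, h3]
  simp
  ring

/-- If |Z| > a + M and |Z'| < M then |Z - Z'| > a, and the independent second event has probability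
at least 1/2. -/
theorem half_mul_measureReal_le_symmetrization {M : ℝ} (hM : G.real {x | M ≤ |x|} ≤ 1 / 2)
    (a : ℝ) : 1 / 2 * G.real {x | a + M < |x|} ≤ (symmetrization G).real {x | a < |x|} := by
  have hms : ∀ b : ℝ, MeasurableSet {x : ℝ | b < |x|} := fun b =>
    measurableSet_lt measurable_const (by fun_prop)
  have h1 : (symmetrization G).real {x | a < |x|} =
      (G.prod (G.map fun x => -x)).real {p : ℝ × ℝ | a < |p.1 + p.2|} := by
    rw [symmetrization, Measure.conv, map_measureReal_apply (by fun_prop) (hms _)]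
    rfl
  have h2 : {x | a + M < |x|} ×ˢ {x | |x| < M} ⊆ {p : ℝ × ℝ | a < |p.1 + p.2|} := by
    rintro ⟨x, y⟩ hp
    simp only [Set.mem_prod, Set.mem_ofPred_eq] at hp ⊢
    have := abs_sub_abs_le_abs_sub x (-y)
    rw [abs_neg, sub_neg_eq_add] at this
    linarith
  have hM2 : MeasurableSet {x : ℝ | M ≤ |x|} := measurableSet_le measurable_const (by fun_prop)
  have h3 : 1 / 2 ≤ (G.map fun x => -x).real {x | |x| < M} := by
    rw [map_measureReal_apply (by fun_prop) (measurableSet_lt (by fun_prop) measurable_const)]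
    have h4 : (fun x : ℝ => -x) ⁻¹' {x | |x| < M} = {x | M ≤ |x|}ᶜ := by
      ext x
      simp
    rw [h4, probReal_compl_eq_one_sub hM2]
    linarith
  rw [h1]
  refine le_trans ?_ (measureReal_mono h2)
  rw [measureReal_prod_prod, mul_comm]
  exact mul_le_mul_of_nonneg_left h3 measureReal_nonneg

/-- If the modulus were identically 1, the symmetrization would be the point mass at 0. Then Z = Z'
almost surely, and fixing one value of Z by Fubini makes `G` a point mass. -/
theorem exists_norm_charFun_lt_one (hG : ∀ x, G ≠ Measure.dirac x) :
    ∃ t, ‖charFun G t‖ < 1 := by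
  by_contra! hcon
  have h1 : ∀ t, ‖charFun G t‖ = 1 := fun t => le_antisymm (norm_charFun_le_one t) (hcon t)
  have h2 : symmetrization G = Measure.dirac 0 := by
    refine Measure.ext_of_charFun (funext fun t => ?_)
    rw [charFun_symmetrization, h1, charFun_dirac]
    simp
  have h3 : ∀ᵐ p ∂(G.prod (G.map fun x => -x)), p.1 + p.2 = 0 := by
    have h4 : ∀ᵐ x ∂(symmetrization G), x = 0 := by
      rw [h2, ae_dirac_iff (measurableSet_eq)]
    rw [symmetrization, Measure.conv, ae_map_iff (by fun_prop) measurableSet_eq] at h4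
    exact h4
  obtain ⟨x, hx⟩ := (Measure.ae_ae_of_ae_prod h3).exists
  rw [ae_map_iff (by fun_prop) (measurableSet_eq_fun (by fun_prop) (by fun_prop))] at hx
  refine hG x ?_
  have h5 : (fun y : ℝ => y) =ᵐ[G] fun _ => x := hx.mono fun y hy => by linarith
  calc G = G.map (fun y => y) := Measure.map_id'.symm
    _ = G.map fun _ => x := Measure.map_congr h5
    _ = _ := by rw [Measure.map_const]; simp

end Symm

/-! ### Consequences of normal attraction: two-sided tails and vanishing mean -/

section Attraction
variable {G : Measure ℝ} [IsProbabilityMeasure G] {α c : ℝ}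

theorem norm_charFun_normalized_sum (n : ℕ) (a b t : ℝ) :
    ‖charFun ((Measure.infinitePi fun _ : ℕ => G).map
      fun z : ℕ → ℝ => ((∑ k ∈ Finset.range n, z k) - a) / b) t‖ = ‖charFun G (t / b)‖ ^ n := by
  have h1 := norm_charFun_map_sum_sub_div (P := Measure.infinitePi fun _ : ℕ => G)
    (X := fun k z => z k) (fun k => measurable_pi_apply k)
    (iIndepFun_infinitePi (X := fun _ x => x) fun _ => measurable_id) n a b t
  rw [h1]
  have h2 : ∀ k, (Measure.infinitePi fun _ : ℕ => G).map (fun z => z k) = G :=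
    fun k => Measure.infinitePi_map_eval _ k
  simp_rw [h2]
  simp

theorem InDomainOfNormalAttraction.tendsto_norm_charFun_pow
    (hG : InDomainOfNormalAttraction G α c) :
    Tendsto (fun n : ℕ => ‖charFun G (1 / (n : ℝ) ^ (1 / α))‖ ^ n) atTop (𝓝 (Real.exp (-c))) := by
  obtain ⟨ν, hν, d, hst, -, hlim⟩ := hG
  have h1 := tendsto_norm_charFun hlim 1
  simp_rw [norm_charFun_normalized_sum] at h1
  rw [hst.charFun_eq, Complex.norm_real, Real.norm_of_nonneg (Real.exp_pos _).le] at h1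
  simpa using h1

/-- Equicontinuity gives x^n ≥ 3/4 for x = |φ(s)|² whenever |s| n^(1/α) ≤ δ. With n the integer part
of (δ/|s|)^α this forces n (1 - x) ≤ 1, since otherwise x^n ≤ e^(-1) < 1/2. -/
theorem InDomainOfNormalAttraction.exists_one_sub_norm_sq_le (hα : 0 < α)
    (hG : InDomainOfNormalAttraction G α c) :
    ∃ K, 0 ≤ K ∧ ∀ s, 1 - ‖charFun G s‖ ^ 2 ≤ K * |s| ^ α := by
  obtain ⟨ν, hν, d, hst, -, hlim⟩ := hG
  obtain ⟨δ, hδ, hev⟩ := exists_eventually_one_sub_norm_sq_le hlim (show (0 : ℝ) < 1 / 4 by norm_num)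
  simp_rw [norm_charFun_normalized_sum] at hev
  obtain ⟨N, hN⟩ := eventually_atTop.1 hev
  set N' : ℕ := max N 1 with hN'
  -- The 2 serves large n, where y < n + 1 ≤ 2n; `N'` serves y < N', where 1 - x ≤ 1 suffices.
  refine ⟨(2 + N') * δ ^ (-α), by positivity, fun s => ?_⟩
  set x := ‖charFun G s‖ ^ 2 with hx
  have hx0 : 0 ≤ x := sq_nonneg _
  rcases eq_or_ne s 0 with rfl | hs
  · simp only [charFun_zero, probReal_univ] at hx
    rw [hx]
    simp [Real.zero_rpow hα.ne']
  have hs' : 0 < |s| := abs_pos.2 hs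
  set y := (δ / |s|) ^ α with hy
  have hy0 : 0 < y := by positivity
  have hyi : δ ^ (-α) * |s| ^ α = 1 / y := by
    rw [hy, Real.div_rpow hδ.le hs'.le, Real.rpow_neg hδ.le]
    field_simp
  rw [mul_assoc, hyi, mul_one_div]
  set n := ⌊y⌋₊ with hn
  by_cases hnN : N' ≤ n
  · have hn1 : 1 ≤ n := (le_max_right _ _).trans hnN
    have hn0 : (0 : ℝ) < n := by exact_mod_cast hn1
    have hny : (n : ℝ) ≤ y := Nat.floor_le hy0.le
    have hyn : y < n + 1 := Nat.lt_floor_add_one y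
    have hroot : (n : ℝ) ^ (1 / α) ≤ δ / |s| := by
      calc (n : ℝ) ^ (1 / α) ≤ y ^ (1 / α) := by gcongr
        _ = δ / |s| := by
          rw [hy, ← Real.rpow_mul (by positivity), mul_one_div_cancel hα.ne', Real.rpow_one]
    have hr0 : 0 < (n : ℝ) ^ (1 / α) := by positivity
    have h1 := hN n ((le_max_left _ _).trans hnN) (s * (n : ℝ) ^ (1 / α)) (by
      rw [abs_mul, abs_of_pos hr0, mul_comm]
      exact (le_div_iff₀ hs').1 hroot)
    rw [mul_div_assoc, div_self hr0.ne', mul_one, ← pow_mul, mul_comm n 2, pow_mul, ← hx] at h1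
    have h2 : (n : ℝ) * (1 - x) ≤ 1 := by
      by_contra! hcon
      have h3 : x ≤ Real.exp (-(1 - x)) := by
        have := Real.add_one_le_exp (-(1 - x)); linarith
      have h4 : x ^ n ≤ Real.exp (-1) := by
        calc x ^ n ≤ (Real.exp (-(1 - x))) ^ n := pow_le_pow_left₀ hx0 h3 n
          _ = Real.exp (n * -(1 - x)) := (Real.exp_nat_mul _ _).symm
          _ ≤ _ := Real.exp_le_exp.2 (by linarith)
      have h5 : Real.exp (-1) < 1 / 2 := by
        rw [Real.exp_neg, inv_lt_comm₀ (Real.exp_pos _) (by norm_num)]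
        have := Real.exp_one_gt_d9
        norm_num
        linarith
      linarith
    rw [le_div_iff₀ hy0]
    have h6 : (1 : ℝ) ≤ n := by exact_mod_cast hn1
    have h7 : 0 ≤ 1 - x := by
      have := norm_charFun_le_one (μ := G) s
      have h8 : x ≤ 1 := pow_le_one₀ (norm_nonneg _) this
      linarith
    have h8 : (0 : ℝ) ≤ N' := Nat.cast_nonneg _
    nlinarith
  · have h1 : y < N' := by
      have := Nat.lt_floor_add_one y
      have h2 : ((n : ℝ) + 1) ≤ N' := by exact_mod_cast Nat.succ_le_of_lt (not_le.1 hnN)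
      linarith
    rw [le_div_iff₀ hy0]
    nlinarith

theorem InDomainOfNormalAttraction.exists_symmetrization_tail_le (hα : 0 < α)
    (hG : InDomainOfNormalAttraction G α c) :
    ∃ K, 0 ≤ K ∧ ∀ a, 0 < a → (symmetrization G).real {x | a < |x|} ≤ K * a ^ (-α) := by
  obtain ⟨K, hK, h⟩ := hG.exists_one_sub_norm_sq_le hα
  refine ⟨2 * K * 2 ^ α, by positivity, fun a ha => ?_⟩
  refine (measureReal_abs_gt_le_integral_charFun ha).trans ?_
  have h1 : ‖∫ t in (-2 * a⁻¹)..(2 * a⁻¹), 1 - charFun (symmetrization G) t‖ ≤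
      K * (2 * a⁻¹) ^ α * |2 * a⁻¹ - -2 * a⁻¹| := by
    refine intervalIntegral.norm_integral_le_of_norm_le_const fun t ht => ?_
    rw [charFun_symmetrization, ← Complex.ofReal_one, ← Complex.ofReal_sub, Complex.norm_real,
      Real.norm_of_nonneg (by
        have := norm_charFun_le_one (μ := G) t
        have h8 : ‖charFun G t‖ ^ 2 ≤ 1 := pow_le_one₀ (norm_nonneg _) this
        linarith)]
    refine (h t).trans ?_
    have ht2 : |t| ≤ 2 * a⁻¹ := by
      have h9 : 0 < a⁻¹ := inv_pos.2 ha
      rw [Set.uIoc_of_le (by linarith)] at ht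
      exact abs_le.2 ⟨by linarith [ht.1], ht.2⟩
    gcongr
  have h2 : |2 * a⁻¹ - -2 * a⁻¹| = 4 * a⁻¹ := by
    rw [abs_of_nonneg (by have : 0 < a⁻¹ := inv_pos.2 ha
                          linarith)]
    ring
  rw [h2] at h1
  calc 2⁻¹ * a * ‖∫ t in (-2 * a⁻¹)..(2 * a⁻¹), 1 - charFun (symmetrization G) t‖
      ≤ 2⁻¹ * a * (K * (2 * a⁻¹) ^ α * (4 * a⁻¹)) := by gcongr
    _ = _ := by
      rw [Real.mul_rpow (by norm_num) (by positivity), Real.inv_rpow ha.le, Real.rpow_neg ha.le]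
      field_simp
      ring

theorem InDomainOfNormalAttraction.exists_tail_le (hα : 0 < α)
    (hG : InDomainOfNormalAttraction G α c) :
    ∃ K, 0 ≤ K ∧ ∀ a, 0 < a → G.real {x | a < |x|} ≤ K * a ^ (-α) := by
  obtain ⟨K, hK, h⟩ := hG.exists_symmetrization_tail_le hα
  obtain ⟨M, hM, hM2⟩ := exists_measureReal_le_abs_lt G (show (0 : ℝ) < 1 / 2 by norm_num)
  -- The second summand makes the bound at least 1 for a ≤ 2M; beyond that a - M ≥ a/2 and
  -- desymmetrization costs a factor 2.
  refine ⟨2 * K * 2 ^ α + (2 * M) ^ α, by positivity, fun a ha => ?_⟩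
  by_cases haM : a ≤ 2 * M
  · refine measureReal_le_one.trans ?_
    have h1 : 1 ≤ (2 * M) ^ α * a ^ (-α) := by
      rw [Real.rpow_neg ha.le, ← div_eq_mul_inv, one_le_div (by positivity)]
      gcongr
    have h2 : 0 ≤ 2 * K * 2 ^ α * a ^ (-α) := by positivity
    rw [add_mul]
    linarith
  · push Not at haM
    have h1 := half_mul_measureReal_le_symmetrization G hM2.le (a - M)
    rw [sub_add_cancel] at h1
    have h2 := h (a - M) (by linarith)
    have h3 : (a - M) ^ (-α) ≤ 2 ^ α * a ^ (-α) := by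
      calc (a - M) ^ (-α) ≤ (a / 2) ^ (-α) :=
            Real.rpow_le_rpow_of_nonpos (by positivity) (by linarith) (by linarith)
        _ = _ := by
            rw [Real.div_rpow ha.le (by norm_num), Real.rpow_neg (by norm_num : (0 : ℝ) ≤ 2)]
            field_simp
    have h4 : K * (a - M) ^ (-α) ≤ K * (2 ^ α * a ^ (-α)) := by gcongr
    have h5 : 0 ≤ (2 * M) ^ α * a ^ (-α) := by positivity
    rw [add_mul]
    nlinarith

/-- Because the limit modulus is e^(-c) < 1, 1 - |φ|² at n^(-1/α) is at least κ/n. Values of the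
symmetrization below η n^(1/α) contribute at most C η^(2-α)/(2n), which is at most half of this for
small η since α < 2. The remainder must come from the tail. -/
theorem InDomainOfNormalAttraction.exists_le_tail (hα : 0 < α) (hα₂ : α < 2) (hc : 0 < c)
    (hG : InDomainOfNormalAttraction G α c) :
    ∃ κ, 0 < κ ∧ ∀ᶠ x : ℝ in atTop, κ * x ^ (-α) ≤ G.real {y | x < |y|} := by
  obtain ⟨K, hK, htail⟩ := hG.exists_symmetrization_tail_le hα
  set C := 2 * K / (2 - α) with hC
  have h2α : 0 < 2 - α := by linarith
  have hC0 : 0 ≤ C := by positivity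
  have hsq : ∀ a, 0 < a → ∫ x, (clamp a x) ^ 2 ∂(symmetrization G) ≤ C * a ^ (2 - α) :=
    fun a ha => integral_clamp_sq_le hK htail hα₂ ha
  -- lower bound on the characteristic function along `n ^ (-1 / α)`
  set ρ := Real.exp (-c) with hρ
  have hρ1 : ρ < 1 := by rw [hρ, ← Real.exp_zero]; exact Real.exp_lt_exp.2 (by linarith)
  have hρ0 : 0 < ρ := Real.exp_pos _
  set κ := (1 - ρ ^ 2) / 2 with hκ
  have hκ0 : 0 < κ := by
    have : ρ ^ 2 < 1 := pow_lt_one₀ hρ0.le hρ1 two_ne_zero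
    rw [hκ]; linarith
  have hlow : ∀ᶠ n : ℕ in atTop, κ ≤ n * (1 - ‖charFun G (1 / (n : ℝ) ^ (1 / α))‖ ^ 2) := by
    have h1 := (hG.tendsto_norm_charFun_pow).pow 2
    have h2 : ρ ^ 2 < 1 - κ := by rw [hκ] at hκ0 ⊢; linarith
    filter_upwards [h1.eventually_lt_const h2] with n hn
    rw [← pow_mul, mul_comm n 2, pow_mul] at hn
    -- Bernoulli's inequality turns x^n < 1 - κ into n (1 - x) > κ.
    have h3 := one_add_mul_le_pow (a := ‖charFun G (1 / (n : ℝ) ^ (1 / α))‖ ^ 2 - 1)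
      (by nlinarith [sq_nonneg (‖charFun G (1 / (n : ℝ) ^ (1 / α))‖)]) n
    rw [add_sub_cancel] at h3
    linarith
  -- the parameter of truncation
  obtain ⟨η, hη, hηC⟩ : ∃ η : ℝ, 0 < η ∧ C * η ^ (2 - α) ≤ κ := by
    refine ⟨(κ / (C + 1)) ^ (1 / (2 - α)), by positivity, ?_⟩
    rw [← Real.rpow_mul (by positivity), one_div_mul_cancel h2α.ne', Real.rpow_one,
      ← mul_div_assoc, div_le_iff₀ (by positivity)]
    nlinarith
  have hH : ∀ᶠ n : ℕ in atTop,
      κ / (4 * n) ≤ (symmetrization G).real {y | η * (n : ℝ) ^ (1 / α) < |y|} := by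
    filter_upwards [hlow, eventually_ge_atTop 1] with n hn hn1
    have hn0 : (0 : ℝ) < n := by exact_mod_cast hn1
    set b := (n : ℝ) ^ (1 / α) with hb
    have hb0 : 0 < b := by positivity
    have hbα : b ^ α = n := by
      rw [hb, ← Real.rpow_mul hn0.le, one_div_mul_cancel hα.ne', Real.rpow_one]
    set a := η * b with ha
    have ha0 : 0 < a := by positivity
    have hms : MeasurableSet {y : ℝ | a < |y|} := measurableSet_lt measurable_const (by fun_prop)
    have hcosint : Integrable (fun y => Real.cos (1 / b * y)) (symmetrization G) :=
      Integrable.of_bound (by fun_prop) 1 (Eventually.of_forall fun y => Real.abs_cos_le_one _)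
    have hexpint : Integrable (fun y : ℝ => Complex.exp ((1 / b : ℝ) * y * Complex.I))
        (symmetrization G) :=
      Integrable.of_bound (by fun_prop) 1 (Eventually.of_forall fun y => by
        rw [show ((1 / b : ℝ) : ℂ) * y * Complex.I = ((1 / b * y : ℝ) : ℂ) * Complex.I by
          push_cast; ring, Complex.norm_exp_ofReal_mul_I])
    have h1 : 1 - ‖charFun G (1 / b)‖ ^ 2 =
        ∫ y, (1 - Real.cos (1 / b * y)) ∂(symmetrization G) := by
      have h2 := charFun_symmetrization G (1 / b)
      rw [charFun_apply_real] at h2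
      have h3 := congrArg Complex.re h2
      rw [Complex.ofReal_re, ← RCLike.re_eq_complex_re, ← integral_re hexpint] at h3
      rw [integral_sub (integrable_const _) hcosint, ← h3]
      simp only [integral_const, probReal_univ, smul_eq_mul, mul_one]
      congr 2
      ext y
      rw [RCLike.re_eq_complex_re, show ((1 / b : ℝ) : ℂ) * y * Complex.I =
        ((1 / b * y : ℝ) : ℂ) * Complex.I by push_cast; ring, Complex.exp_ofReal_mul_I_re]
    have hclint : Integrable (fun y => (clamp a y) ^ 2) (symmetrization G) :=
      Integrable.of_bound ((measurable_clamp a).pow_const 2).aestronglyMeasurable (a ^ 2)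
        (Eventually.of_forall fun y => by
          rw [norm_pow, Real.norm_eq_abs, abs_clamp ha0.le]
          exact pow_le_pow_left₀ (le_min (abs_nonneg _) ha0.le) (min_le_right _ _) 2)
    have h2 : ∫ y, (1 - Real.cos (1 / b * y)) ∂(symmetrization G) ≤
        (1 / b) ^ 2 / 2 * (C * a ^ (2 - α)) + 2 * (symmetrization G).real {y | a < |y|} := by
      calc _ ≤ ∫ y, ((1 / b) ^ 2 / 2 * (clamp a y) ^ 2 +
            {y : ℝ | a < |y|}.indicator (fun _ => (2 : ℝ)) y) ∂(symmetrization G) := by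
            refine integral_mono ((integrable_const _).sub hcosint)
              ((hclint.const_mul _).add ((integrable_const _).indicator hms)) fun y => ?_
            simp only
            by_cases hy : a < |y|
            · rw [Set.indicator_of_mem (show y ∈ {y : ℝ | a < |y|} from hy)]
              have := Real.neg_one_le_cos (1 / b * y)
              have h0 : 0 ≤ (1 / b) ^ 2 / 2 * (clamp a y) ^ 2 := by positivity
              linarith
            · rw [Set.indicator_of_notMem (show y ∉ {y : ℝ | a < |y|} from hy), add_zero,
                clamp_of_abs_le (not_lt.1 hy)]
              have := Real.one_sub_sq_div_two_le_cos (x := 1 / b * y)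
              nlinarith
        _ ≤ _ := by
            rw [integral_add (hclint.const_mul _) ((integrable_const _).indicator hms),
              integral_const_mul, integral_indicator_const _ hms, smul_eq_mul,
              mul_comm _ (2 : ℝ)]
            have := hsq a ha0
            gcongr
    have h3 : (1 / b) ^ 2 / 2 * (C * a ^ (2 - α)) ≤ κ / (2 * n) := by
      have h4 : a ^ (2 - α) = η ^ (2 - α) * (b ^ 2 / n) := by
        rw [ha, Real.mul_rpow hη.le hb0.le, Real.rpow_sub hb0, hbα]
        norm_num
      rw [h4, show (1 / b) ^ 2 / 2 * (C * (η ^ (2 - α) * (b ^ 2 / n))) =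
        (C * η ^ (2 - α)) / (2 * n) by field_simp]
      gcongr
    rw [h1] at hn
    have h5 : κ / n ≤ ∫ y, (1 - Real.cos (1 / b * y)) ∂(symmetrization G) := by
      rw [div_le_iff₀ hn0, mul_comm]; exact hn
    have h6 : κ / (2 * n) = κ / n / 2 := by ring
    have h7 : κ / (4 * n) = κ / n / 4 := by ring
    rw [h6] at h3
    rw [h7]
    linarith
  obtain ⟨N, hN⟩ := eventually_atTop.1 hH
  -- Given x, take n = ⌈(2x/η)^α⌉, so that η n^(1/α) ≥ 2x. The 16 is 4 from the tail estimate, 2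
  -- from rounding up and 2 from desymmetrizing.
  refine ⟨κ / 16 * (2 / η) ^ (-α), by positivity, ?_⟩
  have htop : Tendsto (fun x : ℝ => (2 / η * x) ^ α) atTop atTop :=
    (tendsto_rpow_atTop hα).comp (tendsto_id.const_mul_atTop (by positivity))
  filter_upwards [htop.eventually_ge_atTop (max N 1), eventually_gt_atTop 0] with x hx hx0
  set y := (2 / η * x) ^ α with hy
  have hy1 : 1 ≤ y := (le_max_right _ _).trans hx
  set n := ⌈y⌉₊ with hn
  have hyn : y ≤ n := Nat.le_ceil y
  have hny : (n : ℝ) ≤ 2 * y := by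
    have := Nat.ceil_lt_add_one (show 0 ≤ y by linarith); linarith
  have hNn : N ≤ n := by
    have : (N : ℝ) ≤ n := ((le_max_left _ _).trans hx).trans hyn
    exact_mod_cast this
  have hroot : 2 / η * x ≤ (n : ℝ) ^ (1 / α) := by
    calc 2 / η * x = y ^ (1 / α) := by
          rw [hy, ← Real.rpow_mul (by positivity), mul_one_div_cancel hα.ne', Real.rpow_one]
      _ ≤ _ := by gcongr
  have h1 : (symmetrization G).real {y | η * (n : ℝ) ^ (1 / α) < |y|} ≤
      (symmetrization G).real {y | 2 * x < |y|} := by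
    refine measureReal_mono fun z hz => ?_
    simp only [Set.mem_ofPred_eq] at hz ⊢
    have h2 : 2 * x ≤ η * (n : ℝ) ^ (1 / α) := by
      calc 2 * x = η * (2 / η * x) := by field_simp
        _ ≤ _ := by gcongr
    linarith
  have h2 := measureReal_symmetrization_le G x
  have h3 := hN n hNn
  have hn0 : (0 : ℝ) < n := by linarith
  have h4 : κ / 16 * (2 / η) ^ (-α) * x ^ (-α) = κ / (16 * y) := by
    rw [mul_assoc, ← Real.mul_rpow (by positivity) hx0.le, Real.rpow_neg (by positivity), ← hy]
    field_simp
  have h5 : κ / (16 * y) ≤ κ / (4 * n) / 2 := by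
    rw [div_div κ (4 * (n : ℝ)) 2]
    apply div_le_div_of_nonneg_left hκ0.le (by positivity)
    linarith
  rw [h4]
  linarith

theorem InDomainOfNormalAttraction.integral_eq_zero (hα : 1 < α)
    (hG : InDomainOfNormalAttraction G α c) : ∫ x, x ∂G = 0 := by
  obtain ⟨K, hK, htail⟩ := hG.exists_tail_le (by linarith)
  have hint := integrable_id_of_one_lt hK htail hα
  obtain ⟨ν, hν, d, hst, hd, hlim⟩ := hG
  by_contra hm
  set m := ∫ x, x ∂G with hmdef
  set Q := Measure.infinitePi fun _ : ℕ => G with hQ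
  have hmap : ∀ k, Q.map (fun z => z k) = G := fun k => Measure.infinitePi_map_eval _ k
  have hind : iIndepFun (fun (k : ℕ) (z : ℕ → ℝ) => z k) Q :=
    iIndepFun_infinitePi (X := fun _ x => x) fun _ => measurable_id
  have hslln : ∀ᵐ z ∂Q, Tendsto (fun n : ℕ => (∑ k ∈ Finset.range n, z k) / (n : ℝ)) atTop
      (𝓝 m) := by
    have h1 := strong_law_ae_real (μ := Q) (fun (k : ℕ) (z : ℕ → ℝ) => z k)
      (by
        have h2 : Integrable (fun x : ℝ => x) (Q.map fun z => z 0) := by rw [hmap]; exact hint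
        exact h2.comp_measurable (measurable_pi_apply 0))
      (fun i j hij => hind.indepFun hij)
      (fun i => ⟨(measurable_pi_apply i).aemeasurable, (measurable_pi_apply 0).aemeasurable,
        by rw [hmap, hmap]⟩)
    have h3 : ∫ z, z 0 ∂Q = m := by
      rw [hmdef]
      conv_rhs => rw [← hmap 0]
      rw [integral_map (measurable_pi_apply 0).aemeasurable (by fun_prop)]
    rwa [h3] at h1
  have hmeas := tendstoInMeasure_of_tendsto_ae (f := fun (n : ℕ) (z : ℕ → ℝ) =>
    (∑ k ∈ Finset.range n, z k) / (n : ℝ)) (fun n => by fun_prop) hslln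
  rw [tendstoInMeasure_iff_measureReal_norm] at hmeas
  have h1 := (hmeas (|m| / 2) (by positivity)).eventually_lt_const (show (0 : ℝ) < 1 / 4 by norm_num)
  obtain ⟨M, hM, h2⟩ := exists_eventually_measureReal_le hlim (show (0 : ℝ) < 1 / 2 by norm_num)
  have h3 : Tendsto (fun n : ℕ => |m| / 2 * (n : ℝ) ^ (1 - 1 / α)) atTop atTop := by
    refine Tendsto.const_mul_atTop (by positivity)
      ((tendsto_rpow_atTop ?_).comp tendsto_natCast_atTop_atTop)
    rw [sub_pos, div_lt_one (by linarith)]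
    exact hα
  obtain ⟨n, hn1, hn2, hn3, hn4⟩ := (h1.and (h2.and
    ((h3.eventually_ge_atTop M).and (eventually_ge_atTop 1)))).exists
  rw [map_measureReal_apply (by fun_prop) (measurableSet_le measurable_const (by fun_prop))] at hn2
  have hn0 : (0 : ℝ) < n := by exact_mod_cast hn4
  -- If S_n/n is within |m|/2 of m ≠ 0, then |S_n|/n^(1/α) ≥ (|m|/2) n^(1-1/α) ≥ M. So two events of
  -- total probability below 3/4 would cover the space.
  have hcover : (Set.univ : Set (ℕ → ℝ)) ⊆
      {z | |m| / 2 ≤ ‖(∑ k ∈ Finset.range n, z k) / (n : ℝ) - m‖} ∪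
      (fun z : ℕ → ℝ => ((∑ k ∈ Finset.range n, z k) - d n) / (n : ℝ) ^ (1 / α)) ⁻¹'
        {x | M ≤ |x|} := by
    intro z _
    simp only [Set.mem_union, Set.mem_preimage, Set.mem_ofPred_eq]
    by_contra! hcon
    obtain ⟨hc1, hc2⟩ := hcon
    rw [hd (by linarith) n, sub_zero] at hc2
    set S := ∑ k ∈ Finset.range n, z k
    have e1 : |m| / 2 ≤ |S / n| := by
      rw [Real.norm_eq_abs] at hc1
      have := abs_sub_abs_le_abs_sub m (S / n)
      rw [abs_sub_comm] at this
      linarith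
    have e2 : S / (n : ℝ) ^ (1 / α) = S / n * (n : ℝ) ^ (1 - 1 / α) := by
      rw [Real.rpow_sub hn0, Real.rpow_one]
      field_simp
    rw [e2, abs_mul, abs_of_nonneg (Real.rpow_nonneg hn0.le _)] at hc2
    have e3 : |m| / 2 * (n : ℝ) ^ (1 - 1 / α) ≤ |S / n| * (n : ℝ) ^ (1 - 1 / α) := by gcongr
    linarith
  have h5 := (measureReal_mono (μ := Q) hcover).trans (measureReal_union_le _ _)
  rw [probReal_univ] at h5
  linarith

theorem InDomainOfNormalAttraction.exists_truncationBounds (hα : 0 < α) (hα₂ : α < 2)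
    (hG : InDomainOfNormalAttraction G α c) : ∃ K, 0 ≤ K ∧ TruncationBounds G α K := by
  obtain ⟨K, hK, htail⟩ := hG.exists_tail_le hα
  exact _root_.exists_truncationBounds hK htail hα₂ fun h => hG.integral_eq_zero h

end Attraction

/-! ### The order of the norming constants -/

theorem one_sub_sum_le_prod {x : ℕ → ℝ} (h0 : ∀ k, 0 ≤ x k) (h1 : ∀ k, x k ≤ 1) (n : ℕ) :
    1 - ∑ k ∈ Finset.range n, (1 - x k) ≤ ∏ k ∈ Finset.range n, x k := by
  induction n with
  | zero => simp
  | succ n ih =>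
    rw [Finset.sum_range_succ, Finset.prod_range_succ]
    have h2 : ∏ k ∈ Finset.range n, x k ≤ 1 := Finset.prod_le_one (fun k _ => h0 k) fun k _ => h1 k
    nlinarith [h0 n, h1 n]

theorem sum_ite_const_count (T : ℕ → Prop) [DecidablePred T] (a : ℝ) (n : ℕ) :
    ∑ k ∈ Finset.range n, (if T k then a else 0) = Nat.count T n * a := by
  rw [← Finset.sum_filter, Finset.sum_const, nsmul_eq_mul, ← Nat.count_eq_card_filter_range]

theorem prod_le_pow_count {T : ℕ → Prop} [DecidablePred T] {x : ℕ → ℝ} (h0 : ∀ k, 0 ≤ x k)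
    (h1 : ∀ k, x k ≤ 1) {y : ℝ} (hy : 0 ≤ y) (hxy : ∀ k, T k → x k = y) (n : ℕ) :
    ∏ k ∈ Finset.range n, x k ≤ y ^ Nat.count T n := by
  induction n with
  | zero => simp
  | succ n ih =>
    rw [Finset.prod_range_succ, Nat.count_succ]
    by_cases hT : T n
    · rw [if_pos hT, pow_succ, hxy n hT]
      gcongr
    · rw [if_neg hT, add_zero]
      exact (mul_le_of_le_one_right (Finset.prod_nonneg fun k _ => h0 k) (h1 n)).trans ih

section Norming
variable {Ω : Type*} [MeasurableSpace Ω] {P : Measure Ω} [IsProbabilityMeasure P]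
  {X : ℕ → Ω → ℝ} {A B : ℕ → ℝ} {L : Measure ℝ} [IsProbabilityMeasure L]

theorem exists_eventually_norming_le (hXm : ∀ k, Measurable (X k)) (hXind : iIndepFun X P)
    (hB : ∀ n, 0 < B n) (hL : ∀ x : ℝ, L ≠ Measure.dirac x)
    (hlim : TendstoInDistribution (fun (n : ℕ) (ω : Ω) => (partialSum X n ω - A n) / B n)
      atTop (id : ℝ → ℝ) (fun _ => P) L)
    {T₁ T₂ : ℕ → Prop} [DecidablePred T₁] [DecidablePred T₂] (hT : ∀ k, T₁ k ∨ T₂ k)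
    {α₁ α₂ K : ℝ} (hα₁ : 0 < α₁) (hα₂ : 0 < α₂) (hK : 0 ≤ K)
    (h₁ : ∀ k, T₁ k → ∀ s, 1 - ‖charFun (P.map (X k)) s‖ ^ 2 ≤ K * |s| ^ α₁)
    (h₂ : ∀ k, T₂ k → ∀ s, 1 - ‖charFun (P.map (X k)) s‖ ^ 2 ≤ K * |s| ^ α₂)
    {b : ℕ → ℝ} (hb : ∀ n, 0 < b n) {C : ℝ}
    (hc₁ : ∀ᶠ n in atTop, (Nat.count T₁ n : ℝ) ≤ C * b n ^ α₁)
    (hc₂ : ∀ᶠ n in atTop, (Nat.count T₂ n : ℝ) ≤ C * b n ^ α₂) :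
    ∃ D, 0 < D ∧ ∀ᶠ n in atTop, B n ≤ D * b n := by
  obtain ⟨t, ht⟩ := exists_norm_charFun_lt_one L hL
  set θ := 1 - ‖charFun L t‖ ^ 2 with hθ
  have hθ0 : 0 < θ := sub_pos.2 (pow_lt_one₀ (norm_nonneg _) ht two_ne_zero)
  -- `F (b n / B n)` bounds 1 - |φ_n(t)|², whose limit θ is positive by nondegeneracy. As `F` is
  -- continuous and vanishes at 0, b_n/B_n stays away from 0.
  set F : ℝ → ℝ := fun u => C * K * |t| ^ α₁ * u ^ α₁ + C * K * |t| ^ α₂ * u ^ α₂ with hF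
  have hFc : Continuous F := by
    have e1 := Real.continuous_rpow_const hα₁.le
    have e2 := Real.continuous_rpow_const hα₂.le
    fun_prop
  have hF0 : F 0 < θ / 2 := by
    simp only [hF, Real.zero_rpow hα₁.ne', Real.zero_rpow hα₂.ne']
    simp [hθ0]
  have hev := (hFc.continuousAt.eventually_lt_const hF0).filter_mono
    (nhdsWithin_le_nhds (s := Set.Ioi 0))
  have hprob : ∀ k, IsProbabilityMeasure (P.map (X k)) := fun k =>
    Measure.isProbabilityMeasure_map (hXm k).aemeasurable
  have hlimt := ((tendsto_norm_charFun hlim t).pow 2).const_sub 1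
  have hbig : ∀ᶠ n in atTop, θ / 2 < F (b n / B n) := by
    filter_upwards [hlimt.eventually_const_lt (show θ / 2 < θ by linarith), hc₁, hc₂]
      with n hn hn1 hn2
    refine hn.trans_le ?_
    have hBn := hB n
    have hbn := hb n
    have e1 : ‖charFun (P.map fun ω => (partialSum X n ω - A n) / B n) t‖ ^ 2 =
        ∏ k ∈ Finset.range n, ‖charFun (P.map (X k)) (t / B n)‖ ^ 2 := by
      rw [Finset.prod_pow, ← norm_charFun_map_sum_sub_div hXm hXind n (A n) (B n) t]
      rfl
    rw [e1]
    have e2 := one_sub_sum_le_prod (x := fun k => ‖charFun (P.map (X k)) (t / B n)‖ ^ 2)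
      (fun k => sq_nonneg _) (fun k => pow_le_one₀ (norm_nonneg _) (norm_charFun_le_one _)) n
    have e3 : ∑ k ∈ Finset.range n, (1 - ‖charFun (P.map (X k)) (t / B n)‖ ^ 2) ≤
        Nat.count T₁ n * (K * |t / B n| ^ α₁) + Nat.count T₂ n * (K * |t / B n| ^ α₂) := by
      rw [← sum_ite_const_count, ← sum_ite_const_count, ← Finset.sum_add_distrib]
      refine Finset.sum_le_sum fun k _ => ?_
      have p1 : 0 ≤ K * |t / B n| ^ α₁ := by positivity
      have p2 : 0 ≤ K * |t / B n| ^ α₂ := by positivity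
      rcases hT k with hk | hk
      · rw [if_pos hk]
        refine (h₁ k hk _).trans (le_add_of_nonneg_right ?_)
        split_ifs <;> simp [p2]
      · rw [if_pos hk]
        refine (h₂ k hk _).trans (le_add_of_nonneg_left ?_)
        split_ifs <;> simp [p1]
    have e4 : ∀ α : ℝ, ∀ N : ℝ, N ≤ C * b n ^ α →
        N * (K * |t / B n| ^ α) ≤ C * K * |t| ^ α * (b n / B n) ^ α := by
      intro α N hN
      rw [abs_div, abs_of_pos hBn, Real.div_rpow (abs_nonneg _) hBn.le,
        Real.div_rpow hbn.le hBn.le]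
      calc N * (K * (|t| ^ α / B n ^ α)) ≤ C * b n ^ α * (K * (|t| ^ α / B n ^ α)) := by
            gcongr
        _ = _ := by ring
    have e5 := e4 α₁ _ hn1
    have e6 := e4 α₂ _ hn2
    simp only [hF]
    linarith
  obtain ⟨u, hu, hu0⟩ := (mem_nhdsGT_iff_exists_Ioo_subset.1 hev)
  refine ⟨2 / u, by have : 0 < u := hu; positivity, hbig.mono fun n hn => ?_⟩
  have hu' : 0 < u := hu
  by_contra! hcon
  have hbB : b n / B n < u := by
    rw [div_lt_iff₀ (hB n)]
    have : 2 * b n < B n * u := by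
      rw [div_mul_eq_mul_div, div_lt_iff₀ hu'] at hcon; exact hcon
    nlinarith [hb n]
  have := hu0 (show b n / B n ∈ Set.Ioo 0 u from ⟨div_pos (hb n) (hB n), hbB⟩)
  simp only [Set.mem_ofPred_eq] at this
  linarith

/-- Were B_n small against b = (N + 1)^(1/α), the point B_n/b would lie in the equicontinuity
neighbourhood of 0. There the factors of type `T` alone keep the squared modulus of the product near
or below e^(-c) < 1. -/
theorem exists_eventually_le_norming (hXm : ∀ k, Measurable (X k)) (hXind : iIndepFun X P)
    (hB : ∀ n, 0 < B n)
    (hlim : TendstoInDistribution (fun (n : ℕ) (ω : Ω) => (partialSum X n ω - A n) / B n)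
      atTop (id : ℝ → ℝ) (fun _ => P) L)
    {T : ℕ → Prop} [DecidablePred T] {G : Measure ℝ} [IsProbabilityMeasure G]
    (hlaw : ∀ k, T k → P.map (X k) = G) (hcount : Tendsto (Nat.count T) atTop atTop)
    {α c : ℝ} (hc : 0 < c) (hG : InDomainOfNormalAttraction G α c) :
    ∃ D, 0 < D ∧ ∀ᶠ n in atTop, ((Nat.count T n : ℝ) + 1) ^ (1 / α) ≤ D * B n := by
  have hprob : ∀ k, IsProbabilityMeasure (P.map (X k)) := fun k =>
    Measure.isProbabilityMeasure_map (hXm k).aemeasurable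
  set ρ := Real.exp (-c) with hρ
  have hρ1 : ρ < 1 := by rw [hρ, ← Real.exp_zero]; exact Real.exp_lt_exp.2 (by linarith)
  obtain ⟨δ, hδ, hev⟩ := exists_eventually_one_sub_norm_sq_le hlim
    (show 0 < (1 - ρ) / 2 by linarith)
  refine ⟨1 / δ, by positivity, ?_⟩
  have hpow := hG.tendsto_norm_charFun_pow.comp ((tendsto_add_atTop_nat 1).comp hcount)
  filter_upwards [hev, hpow.eventually_lt_const (show ρ < (1 + ρ) / 2 by linarith),
    hcount.eventually_ge_atTop 1] with n hn hn2 hn3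
  have hBn := hB n
  set N := Nat.count T n with hN
  simp only [Function.comp] at hn2
  push_cast at hn2
  set b := ((N : ℝ) + 1) ^ (1 / α) with hb
  have hb0 : 0 < b := by positivity
  by_contra! hcon
  have h1 := hn (B n / b) (by
    rw [abs_of_pos (by positivity), div_le_iff₀ hb0]
    rw [one_div_mul_eq_div, div_lt_iff₀ hδ] at hcon
    linarith)
  have e1 : ‖charFun (P.map fun ω => (partialSum X n ω - A n) / B n) (B n / b)‖ =
      ∏ k ∈ Finset.range n, ‖charFun (P.map (X k)) (1 / b)‖ := by
    have := norm_charFun_map_sum_sub_div hXm hXind n (A n) (B n) (B n / b)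
    rw [show B n / b / B n = 1 / b by field_simp] at this
    exact this
  have e2 := prod_le_pow_count (T := T) (x := fun k => ‖charFun (P.map (X k)) (1 / b)‖)
    (fun k => norm_nonneg _) (fun k => norm_charFun_le_one _) (norm_nonneg (charFun G (1 / b)))
    (fun k hk => by rw [hlaw k hk]) n
  rw [← e1] at e2
  -- Squaring raises the exponent to 2N ≥ N + 1, matching b, the normalization of a sum of N + 1
  -- terms.
  have e3 : ‖charFun (P.map fun ω => (partialSum X n ω - A n) / B n) (B n / b)‖ ^ 2 ≤
      ‖charFun G (1 / b)‖ ^ (N + 1) := by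
    calc _ ≤ (‖charFun G (1 / b)‖ ^ N) ^ 2 := pow_le_pow_left₀ (norm_nonneg _) e2 2
      _ = ‖charFun G (1 / b)‖ ^ (N * 2) := (pow_mul _ _ _).symm
      _ ≤ _ := pow_le_pow_of_le_one (norm_nonneg _) (norm_charFun_le_one _) (by omega)
  linarith

end Norming

/-! ### The comparison norming sequence -/

/-- The sequence `((N + 1) f (n + 1)) ^ (1 / α)`, where `N` is the number of indices `k ≤ n`
satisfying `T`. -/
noncomputable def normSeq (T : ℕ → Prop) [DecidablePred T] (f : ℝ → ℝ) (α : ℝ) (n : ℕ) : ℝ :=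
  (((Nat.count T (n + 1) : ℝ) + 1) * f ((n : ℝ) + 1)) ^ (1 / α)

section NormSeq
variable {T : ℕ → Prop} [DecidablePred T] {f : ℝ → ℝ} {α : ℝ}
  (hα : 0 < α) (hfpos : ∀ x, 1 ≤ x → 0 < f x) (hfmono : MonotoneOn f (Set.Ici 1))

theorem one_le_cast_add_one (n : ℕ) : (1 : ℝ) ≤ (n : ℝ) + 1 :=
  le_add_of_nonneg_left (Nat.cast_nonneg n)

include hfpos

theorem normSeq_base_pos (n : ℕ) : 0 < ((Nat.count T (n + 1) : ℝ) + 1) * f ((n : ℝ) + 1) :=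
  mul_pos (by positivity) (hfpos _ (one_le_cast_add_one n))

theorem normSeq_pos (n : ℕ) : 0 < normSeq T f α n :=
  Real.rpow_pos_of_pos (normSeq_base_pos hfpos n) _

theorem normSeq_rpow (n : ℕ) (r : ℝ) :
    normSeq T f α n ^ r = (((Nat.count T (n + 1) : ℝ) + 1) * f ((n : ℝ) + 1)) ^ (r / α) := by
  rw [normSeq, ← Real.rpow_mul (normSeq_base_pos hfpos n).le]
  congr 1
  ring

include hα in
theorem normSeq_rpow_neg_self (n : ℕ) :
    normSeq T f α n ^ (-α) = 1 / (((Nat.count T (n + 1) : ℝ) + 1) * f ((n : ℝ) + 1)) := by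
  rw [normSeq_rpow hfpos, neg_div, div_self hα.ne', Real.rpow_neg_one, one_div]

include hfmono

include hα in
theorem normSeq_monotone : Monotone (normSeq T f α) := by
  intro m n hmn
  have hmn' : (m : ℝ) + 1 ≤ (n : ℝ) + 1 := by
    have : (m : ℝ) ≤ n := Nat.cast_le.2 hmn
    linarith
  have h1 : (Nat.count T (m + 1) : ℝ) ≤ Nat.count T (n + 1) :=
    Nat.cast_le.2 (Nat.count_monotone T (by omega))
  have h2 := hfmono (one_le_cast_add_one m) (one_le_cast_add_one n) hmn'
  have h3 := hfpos _ (one_le_cast_add_one m)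
  unfold normSeq
  gcongr

include hα in
theorem tendsto_normSeq (hT : Tendsto (Nat.count T) atTop atTop) :
    Tendsto (normSeq T f α) atTop atTop := by
  have h1 : Tendsto (fun n => (((Nat.count T (n + 1) : ℝ) + 1) * f 1)) atTop atTop :=
    (tendsto_atTop_add_const_right _ _ (tendsto_natCast_atTop_atTop.comp
      (hT.comp (tendsto_add_atTop_nat 1)))).atTop_mul_const (hfpos 1 le_rfl)
  have h2 := (tendsto_rpow_atTop (one_div_pos.2 hα)).comp h1
  refine tendsto_atTop_mono (fun n => ?_) h2
  have h3 := hfpos 1 le_rfl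
  have h4 := hfmono (Set.self_mem_Ici) (one_le_cast_add_one n) (one_le_cast_add_one n)
  simp only [Function.comp, normSeq]
  gcongr

/-- The count up to k is at most k, so monotonicity of `f` allows the argument of `f` to be replaced
by the count; reindexing then applies. -/
theorem summable_ite_one_div_count
    (hs : Summable fun m : ℕ => 1 / (((m : ℝ) + 1) * f ((m : ℝ) + 1))) :
    Summable fun k => if T k then 1 / (((Nat.count T k : ℝ) + 1) * f ((k : ℝ) + 1)) else 0 := by
  have h := summable_ite_count (p := T) (h := fun m : ℕ => 1 / (((m : ℝ) + 1) * f ((m : ℝ) + 1)))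
    (fun m => (one_div_pos.2 (mul_pos (by positivity) (hfpos _ (one_le_cast_add_one m)))).le) hs
  refine Summable.of_nonneg_of_le (fun k => ?_) (fun k => ?_) h
  · split_ifs
    · exact (one_div_pos.2 (mul_pos (by positivity) (hfpos _ (one_le_cast_add_one k)))).le
    · exact le_rfl
  · split_ifs
    · have h1 : (Nat.count T k : ℝ) + 1 ≤ (k : ℝ) + 1 := by
        have : (Nat.count T k : ℝ) ≤ k := Nat.cast_le.2 (Nat.count_le T)
        linarith
      have h2 := hfmono (one_le_cast_add_one _) (one_le_cast_add_one k) h1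
      have h3 := hfpos _ (one_le_cast_add_one (Nat.count T k))
      apply one_div_le_one_div_of_le (by positivity)
      gcongr
    · exact le_rfl

include hα in
theorem summable_normSeq_rpow_neg_self
    (hs : Summable fun m : ℕ => 1 / (((m : ℝ) + 1) * f ((m : ℝ) + 1))) :
    Summable fun k => if T k then normSeq T f α k ^ (-α) else 0 := by
  refine Summable.of_nonneg_of_le (fun k => ?_) (fun k => ?_)
    (summable_ite_one_div_count (T := T) hfpos hfmono hs)
  · split_ifs
    · exact Real.rpow_nonneg (normSeq_pos hfpos k).le _
    · exact le_rfl
  · split_ifs with hk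
    · rw [normSeq_rpow_neg_self hα hfpos]
      have h3 := hfpos _ (one_le_cast_add_one k)
      apply one_div_le_one_div_of_le (by positivity)
      have : (Nat.count T k : ℝ) ≤ Nat.count T (k + 1) :=
        Nat.cast_le.2 (Nat.count_monotone T (Nat.le_succ k))
      gcongr
    · exact le_rfl

omit hfmono

omit hfpos in
include hα in
theorem exists_log_normSeq_le (hf : ∀ᶠ n : ℕ in atTop, 1 ≤ f ((n : ℝ) + 1)) :
    ∃ C, 0 ≤ C ∧ ∀ᶠ n : ℕ in atTop, Real.log (1 + normSeq T f α n) ≤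
      C * (Real.log ((n : ℝ) + 1) + Real.log (1 + f ((n : ℝ) + 1))) := by
  set q := 1 / α with hq
  have hq0 : 0 < q := one_div_pos.2 hα
  refine ⟨1 + 2 * q, by positivity, ?_⟩
  filter_upwards [hf, eventually_ge_atTop 1] with n hn hn1
  have hn1' : (1 : ℝ) ≤ n := by exact_mod_cast hn1
  set y := f ((n : ℝ) + 1)
  have hN : (Nat.count T (n + 1) : ℝ) ≤ (n : ℝ) + 1 := by exact_mod_cast Nat.count_le T
  set x := ((Nat.count T (n + 1) : ℝ) + 1) * y with hx
  have hx1 : 1 ≤ x := by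
    have : (0 : ℝ) ≤ Nat.count T (n + 1) := Nat.cast_nonneg _
    nlinarith
  have h1 : 1 ≤ x ^ q := Real.one_le_rpow hx1 hq0.le
  have h2 : x ≤ ((n : ℝ) + 1) ^ 2 * (1 + y) := by
    calc x ≤ ((n : ℝ) + 1 + 1) * y := by rw [hx]; gcongr
      _ ≤ _ := mul_le_mul (by nlinarith) (by linarith) (by linarith) (by positivity)
  have h3 : Real.log x ≤ 2 * Real.log ((n : ℝ) + 1) + Real.log (1 + y) := by
    refine (Real.log_le_log (by linarith) h2).trans_eq ?_
    rw [Real.log_mul (by positivity) (by positivity), Real.log_pow]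
    push_cast
    ring
  have h4 : Real.log (1 + x ^ q) ≤ Real.log 2 + q * Real.log x := by
    rw [← Real.log_rpow (by linarith), ← Real.log_mul (by norm_num) (by positivity)]
    exact Real.log_le_log (by positivity) (by linarith)
  have h5 : Real.log 2 ≤ Real.log ((n : ℝ) + 1) := Real.log_le_log (by norm_num) (by linarith)
  have h6 : 0 ≤ Real.log (1 + y) := Real.log_nonneg (by linarith)
  have h7 : 0 ≤ Real.log 2 := Real.log_nonneg (by norm_num)
  have h8 : normSeq T f α n = x ^ q := rfl
  rw [h8]
  nlinarith [mul_le_mul_of_nonneg_left h3 hq0.le, mul_nonneg hq0.le h6]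

end NormSeq

/-! ### The two Borel–Cantelli halves -/

section LimSup
variable {Ω : Type*} [MeasurableSpace Ω] {P : Measure Ω} [IsProbabilityMeasure P]
  {X : ℕ → Ω → ℝ} {B : ℕ → ℝ} {T : ℕ → Prop} [DecidablePred T] {f : ℝ → ℝ} {α : ℝ}

theorem ae_normedLimsup_eq_zero (hXm : ∀ k, Measurable (X k)) (hXind : iIndepFun X P)
    (hB : ∀ n, 0 < B n) {G G' : Measure ℝ} [IsProbabilityMeasure G] [IsProbabilityMeasure G']
    (hlaw : ∀ k, T k → P.map (X k) = G) (hlaw' : ∀ k, ¬ T k → P.map (X k) = G')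
    (hcount : Tendsto (Nat.count T) atTop atTop) {α' K K' : ℝ} (hα : 0 < α)
    (hK : 0 ≤ K) (hK' : 0 ≤ K') (hG : TruncationBounds G α K) (hG' : TruncationBounds G' α' K')
    (hfpos : ∀ x, 1 ≤ x → 0 < f x) (hfmono : MonotoneOn f (Set.Ici 1))
    {D : ℝ} (hBD : ∀ᶠ n in atTop, ((Nat.count T n : ℝ) + 1) ^ (1 / α) ≤ D * B n)
    (hs : Summable fun k => if T k then normSeq T f α k ^ (-α) else 0)
    (hs' : Summable fun k => if ¬ T k then normSeq T f α k ^ (-α') else 0)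
    (h1 : α = 1 → Tendsto (fun n => (Nat.count T (n + 1) : ℝ) *
      Real.log (1 + normSeq T f α n) / normSeq T f α n) atTop (𝓝 0))
    (h1' : α' = 1 → Tendsto (fun n => (Nat.count (fun k => ¬ T k) (n + 1) : ℝ) *
      Real.log (1 + normSeq T f α n) / normSeq T f α n) atTop (𝓝 0)) :
    ∀ᵐ ω ∂P, normedLimsup X B f α ω = 0 := by
  have hmono := normSeq_monotone (T := T) hα hfpos hfmono
  have hpos := fun n => normSeq_pos (T := T) (α := α) hfpos n
  have htop := tendsto_normSeq hα hfpos hfmono hcount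
  filter_upwards [ae_tendsto_sum_ite_div hXm hXind hlaw hK hG hmono hpos htop hs h1,
    ae_tendsto_sum_ite_div hXm hXind (T := fun k => ¬ T k) hlaw' hK' hG' hmono hpos htop hs' h1']
    with ω hω hω'
  have h2 := ((hω.add hω').abs).const_mul D
  simp only [add_zero, abs_zero, mul_zero] at h2
  -- `normSeq` at `n` norms the sum of the first n + 1 terms, hence the shift by one.
  have h3 : Tendsto (fun n : ℕ => |partialSum X (n + 1) ω| /
      (B (n + 1) * f ((n + 1 : ℕ) : ℝ) ^ (1 / α))) atTop (𝓝 0) := by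
    refine squeeze_zero' ?_ ?_ h2
    · refine Eventually.of_forall fun n => ?_
      have := hfpos _ (one_le_cast_add_one n)
      have := hB (n + 1)
      push_cast
      positivity
    · filter_upwards [(tendsto_add_atTop_nat 1).eventually hBD] with n hn
      have hf := hfpos _ (one_le_cast_add_one n)
      have hBn := hB (n + 1)
      have hw := hpos n
      have hsum : (∑ k ∈ Finset.range (n + 1), if T k then X k ω else 0) / normSeq T f α n +
          (∑ k ∈ Finset.range (n + 1), if ¬ T k then X k ω else 0) / normSeq T f α n =
          partialSum X (n + 1) ω / normSeq T f α n := by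
        rw [← add_div, ← Finset.sum_add_distrib, partialSum]
        congr 1
        refine Finset.sum_congr rfl fun k _ => ?_
        by_cases hk : T k <;> simp [hk]
      rw [hsum, abs_div, abs_of_pos hw, ← mul_div_assoc]
      push_cast
      rw [div_le_div_iff₀ (by positivity) hw]
      have h4 : normSeq T f α n ≤ D * (B (n + 1) * f ((n : ℝ) + 1) ^ (1 / α)) := by
        rw [normSeq, Real.mul_rpow (by positivity) hf.le, ← mul_assoc]
        gcongr
      calc |partialSum X (n + 1) ω| * normSeq T f α n
          ≤ |partialSum X (n + 1) ω| * (D * (B (n + 1) * f ((n : ℝ) + 1) ^ (1 / α))) := by gcongr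
        _ = _ := by ring
  have h4 := (tendsto_add_atTop_iff_nat (f := fun n : ℕ => |partialSum X n ω| /
    (B n * f (n : ℝ) ^ (1 / α))) 1).1 h3
  have h5 := ENNReal.tendsto_ofReal h4
  rw [ENNReal.ofReal_zero] at h5
  exact h5.limsup_eq

theorem ae_frequently_lt_abs (hXm : ∀ k, Measurable (X k)) (hXind : iIndepFun X P)
    {G : Measure ℝ} [IsProbabilityMeasure G] (hlaw : ∀ k, T k → P.map (X k) = G)
    (hcount : Tendsto (Nat.count T) atTop atTop) (hα : 0 < α) {κ : ℝ} (hκ : 0 < κ)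
    (htail : ∀ᶠ x : ℝ in atTop, κ * x ^ (-α) ≤ G.real {y | x < |y|})
    (hfpos : ∀ x, 1 ≤ x → 0 < f x) (hfmono : MonotoneOn f (Set.Ici 1)) {p : ℕ}
    (hp : ∀ᶠ k : ℕ in atTop, T k → (k : ℝ) + 1 ≤ ((Nat.count T k : ℝ) + 1) ^ p)
    (hs : ¬ Summable fun m : ℕ => 1 / (((m : ℝ) + 1) * f (((m : ℝ) + 1) ^ p)))
    {M : ℝ} (hM : 0 < M) :
    ∀ᵐ ω ∂P, ∃ᶠ k in atTop, M * normSeq T f α k < |X k ω| := by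
  have htop := tendsto_normSeq hα hfpos hfmono hcount
  -- Putting `T k` inside the set makes the events of the other type empty, while keeping one
  -- independent family over all indices.
  set U : ℕ → Set ℝ := fun k => {x | T k ∧ M * normSeq T f α k < |x|} with hU
  have hUm : ∀ k, MeasurableSet (U k) := fun k =>
    (MeasurableSet.const (T k)).inter (measurableSet_lt (f := fun _ => M * normSeq T f α k)
      (g := fun x : ℝ => |x|) measurable_const (by fun_prop))
  set E : ℕ → Set Ω := fun k => X k ⁻¹' U k with hE
  have hEm : ∀ k, MeasurableSet (E k) := fun k => hXm k (hUm k)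
  have hind : iIndepSet E P := by
    rw [iIndepSet_iff_meas_biInter hEm]
    intro S
    exact hXind.measure_inter_preimage_eq_mul S fun k _ => hUm k
  have hsum : ∑' k, P (E k) = ∞ := by
    by_contra hne
    have hsE := ENNReal.summable_toReal hne
    apply hs
    have hnn : ∀ m : ℕ, 0 ≤ 1 / (((m : ℝ) + 1) * f (((m : ℝ) + 1) ^ p)) := fun m =>
      (one_div_pos.2 (mul_pos (by positivity) (hfpos _ (one_le_pow₀ (one_le_cast_add_one m))))).le
    refine summable_of_summable_ite_count (p := T) hnn hcount ?_
    refine Summable.of_norm_bounded_eventually_nat (hsE.mul_left (2 * M ^ α / κ)) ?_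
    filter_upwards [(htop.const_mul_atTop hM).eventually htail, hp] with k hk hpk
    by_cases hTk : T k
    · have hpk := hpk hTk
      rw [if_pos hTk, Real.norm_of_nonneg (hnn _)]
      have e1 : (P (E k)).toReal = G.real {y | M * normSeq T f α k < |y|} := by
        rw [← hlaw k hTk, map_measureReal_apply (hXm k)
          (measurableSet_lt measurable_const (by fun_prop))]
        simp only [hE, hU, hTk, true_and]
        rfl
      rw [e1]
      have e2 : κ * (M * normSeq T f α k) ^ (-α) =
          κ / M ^ α * (1 / (((Nat.count T k : ℝ) + 1 + 1) * f ((k : ℝ) + 1))) := by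
        rw [Real.mul_rpow hM.le (normSeq_pos hfpos k).le, normSeq_rpow_neg_self hα hfpos,
          Real.rpow_neg hM.le, Nat.count_succ, if_pos hTk]
        push_cast
        ring
      rw [e2] at hk
      have hfk := hfpos _ (one_le_cast_add_one k)
      -- This replaces k by a power of the count, after which the divergent series depends on the
      -- count alone.
      have e3 : f ((k : ℝ) + 1) ≤ f (((Nat.count T k : ℝ) + 1) ^ p) :=
        hfmono (one_le_cast_add_one k) (one_le_pow₀ (one_le_cast_add_one _)) hpk
      calc 1 / (((Nat.count T k : ℝ) + 1) * f (((Nat.count T k : ℝ) + 1) ^ p))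
          ≤ 2 * (1 / (((Nat.count T k : ℝ) + 1 + 1) * f ((k : ℝ) + 1))) := by
            have hc0 : (0 : ℝ) ≤ Nat.count T k := Nat.cast_nonneg _
            have hfp := hfk.trans_le e3
            rw [mul_one_div, div_le_div_iff₀ (by positivity) (by positivity)]
            calc 1 * (((Nat.count T k : ℝ) + 1 + 1) * f ((k : ℝ) + 1))
                ≤ 1 * ((2 * ((Nat.count T k : ℝ) + 1)) * f (((Nat.count T k : ℝ) + 1) ^ p)) := by
                  gcongr
                  linarith
              _ = _ := by ring
        _ = 2 * M ^ α / κ * (κ / M ^ α *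
            (1 / (((Nat.count T k : ℝ) + 1 + 1) * f ((k : ℝ) + 1)))) := by
            field_simp
        _ ≤ _ := by gcongr
    · rw [if_neg hTk, norm_zero]
      positivity
  have h1 := measure_limsup_eq_one hEm hind hsum
  have h2 : ∀ᵐ ω ∂P, ω ∈ limsup E atTop := by
    rw [← mem_ae_iff_prob_eq_one (MeasurableSet.measurableSet_limsup hEm)] at h1
    exact h1
  filter_upwards [h2] with ω hω
  rw [mem_limsup_iff_frequently_mem] at hω
  refine hω.mono fun k hk => ?_
  simp only [hE, hU, Set.mem_preimage, Set.mem_ofPred_eq] at hk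
  exact hk.2

theorem ae_normedLimsup_eq_top (hXm : ∀ k, Measurable (X k)) (hXind : iIndepFun X P)
    (hB : ∀ n, 0 < B n)
    {G : Measure ℝ} [IsProbabilityMeasure G] (hlaw : ∀ k, T k → P.map (X k) = G)
    (hcount : Tendsto (Nat.count T) atTop atTop) (hα : 0 < α) {κ : ℝ} (hκ : 0 < κ)
    (htail : ∀ᶠ x : ℝ in atTop, κ * x ^ (-α) ≤ G.real {y | x < |y|})
    (hfpos : ∀ x, 1 ≤ x → 0 < f x) (hfmono : MonotoneOn f (Set.Ici 1)) {p : ℕ}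
    (hp : ∀ᶠ k : ℕ in atTop, T k → (k : ℝ) + 1 ≤ ((Nat.count T k : ℝ) + 1) ^ p)
    (hs : ¬ Summable fun m : ℕ => 1 / (((m : ℝ) + 1) * f (((m : ℝ) + 1) ^ p)))
    {D : ℝ} (hD : 0 < D) (hBD : ∀ᶠ n in atTop, B n ≤ D * ((Nat.count T n : ℝ) + 1) ^ (1 / α)) :
    ∀ᵐ ω ∂P, normedLimsup X B f α ω = ∞ := by
  have hmono := normSeq_monotone (T := T) hα hfpos hfmono
  have hpos := fun n => normSeq_pos (T := T) (α := α) hfpos n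
  have hfreq : ∀ᵐ ω ∂P, ∀ M : ℕ, ∃ᶠ k in atTop, ((M : ℝ) + 1) * normSeq T f α k < |X k ω| :=
    ae_all_iff.2 fun M => ae_frequently_lt_abs hXm hXind hlaw hcount hα hκ htail hfpos hfmono hp hs
      (by positivity)
  filter_upwards [hfreq] with ω hω
  by_contra hne
  obtain ⟨M, hM⟩ := ENNReal.lt_iff_exists_nnreal_btwn.1 (lt_top_iff_ne_top.2 hne)
  have h1 := eventually_lt_of_limsup_lt hM.1
  have h2 : ∀ᶠ n : ℕ in atTop, |partialSum X (n + 1) ω| ≤ M * D * normSeq T f α n := by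
    filter_upwards [(tendsto_add_atTop_nat 1).eventually h1,
      (tendsto_add_atTop_nat 1).eventually hBD] with n hn hn2
    have hf := hfpos _ (one_le_cast_add_one n)
    have hBn := hB (n + 1)
    rw [← ENNReal.ofReal_coe_nnreal] at hn
    have h3 : |partialSum X (n + 1) ω| / (B (n + 1) * f ((n + 1 : ℕ) : ℝ) ^ (1 / α)) < M := by
      refine (ENNReal.ofReal_lt_ofReal_iff_of_nonneg ?_).1 hn
      push_cast
      positivity
    push_cast at h3
    rw [div_lt_iff₀ (by positivity)] at h3
    refine h3.le.trans ?_
    rw [normSeq, Real.mul_rpow (by positivity) hf.le, mul_assoc, ← mul_assoc D]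
    gcongr
  obtain ⟨N, hN⟩ := eventually_atTop.1 h2
  -- The 2 accounts for the two consecutive partial sums whose difference is the large summand.
  obtain ⟨M', hM'⟩ := exists_nat_gt (2 * (M * D))
  obtain ⟨k, hk, hkN⟩ := ((hω M').and_eventually (eventually_ge_atTop (N + 1))).exists
  obtain ⟨j, rfl⟩ : ∃ j, k = j + 1 := ⟨k - 1, by omega⟩
  have h3 := hN (j + 1) (by omega)
  have h4 := hN j (by omega)
  have h5 : X (j + 1) ω = partialSum X (j + 1 + 1) ω - partialSum X (j + 1) ω := by
    simp only [partialSum]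
    rw [Finset.sum_range_succ _ (j + 1)]
    ring
  have h6 : |X (j + 1) ω| ≤ |partialSum X (j + 1 + 1) ω| + |partialSum X (j + 1) ω| := by
    rw [h5]; exact abs_sub _ _
  have h7 := hmono (Nat.le_succ j)
  have h8 := hpos (j + 1)
  have h9 : 0 ≤ (M : ℝ) * D := by positivity
  have h10 := mul_le_mul_of_nonneg_left h7 h9
  have h11 := mul_lt_mul_of_pos_right hM' h8
  simp only [Nat.succ_eq_add_one] at h10
  nlinarith

end LimSup

/-! ### Growth of f and of the norming sequence when the integral converges -/

theorem tendsto_log_one_add_div_rpow {r : ℝ} (hr : 0 < r) :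
    Tendsto (fun x : ℝ => Real.log (1 + x) / x ^ r) atTop (𝓝 0) := by
  have h1 : Tendsto (fun x : ℝ => Real.log (1 + x) / (1 + x) ^ r) atTop (𝓝 0) :=
    ((isLittleO_log_rpow_atTop hr).tendsto_div_nhds_zero).comp
      (tendsto_atTop_add_const_left _ 1 tendsto_id)
  have h2 := h1.const_mul (2 ^ r)
  rw [mul_zero] at h2
  refine squeeze_zero' ?_ ?_ h2
  · filter_upwards [eventually_ge_atTop 1] with x hx
    exact div_nonneg (Real.log_nonneg (by linarith)) (by positivity)
  · filter_upwards [eventually_ge_atTop 1] with x hx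
    have h3 : 0 ≤ Real.log (1 + x) := Real.log_nonneg (by linarith)
    have h4 : (1 + x) ^ r ≤ 2 ^ r * x ^ r := by
      rw [← Real.mul_rpow (by norm_num) (by linarith)]
      exact Real.rpow_le_rpow (by linarith) (by linarith) hr.le
    rw [← mul_div_assoc, div_le_div_iff₀ (by positivity) (by positivity)]
    nlinarith

theorem tendsto_log_cast_add_one : Tendsto (fun n : ℕ => Real.log ((n : ℝ) + 1)) atTop atTop :=
  Real.tendsto_log_atTop.comp (tendsto_atTop_add_const_right _ _ tendsto_natCast_atTop_atTop)

section Growth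
variable {f : ℝ → ℝ} (hfpos : ∀ x, 1 ≤ x → 0 < f x) (hfmono : MonotoneOn f (Set.Ici 1))
  (hf : logIntegral f < ∞)
include hfpos hfmono hf

theorem tendsto_log_add_one_div : Tendsto (fun n : ℕ => Real.log ((n : ℝ) + 1) / f ((n : ℝ) + 1))
    atTop (𝓝 0) := by
  have h := (tendsto_log_div_of_logIntegral hfpos hfmono hf).comp (tendsto_add_atTop_nat 1)
  refine h.congr fun n => ?_
  simp only [Function.comp]
  push_cast
  rfl

theorem eventually_log_le : ∀ᶠ n : ℕ in atTop, Real.log ((n : ℝ) + 1) ≤ f ((n : ℝ) + 1) := by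
  filter_upwards [(tendsto_log_add_one_div hfpos hfmono hf).eventually_lt_const one_pos] with n hn
  exact ((div_lt_one (hfpos _ (one_le_cast_add_one n))).1 hn).le

theorem tendsto_comp_cast_add_one : Tendsto (fun n : ℕ => f ((n : ℝ) + 1)) atTop atTop :=
  tendsto_atTop_mono' _ (eventually_log_le hfpos hfmono hf)
    tendsto_log_cast_add_one

variable {T : ℕ → Prop} [DecidablePred T] {α α' : ℝ} (hα : 0 < α)
include hα

theorem exists_eventually_log_normSeq_le :
    ∃ C, 0 ≤ C ∧ ∀ᶠ n : ℕ in atTop, Real.log (1 + normSeq T f α n) ≤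
      C * (Real.log ((n : ℝ) + 1) + Real.log (1 + f ((n : ℝ) + 1))) :=
  exists_log_normSeq_le hα ((tendsto_comp_cast_add_one hfpos hfmono hf).eventually_ge_atTop 1)

theorem tendsto_log_normSeq_div :
    Tendsto (fun n => Real.log (1 + normSeq T f α n) / f ((n : ℝ) + 1)) atTop (𝓝 0) := by
  obtain ⟨C, hC, hev⟩ := exists_eventually_log_normSeq_le (T := T) hfpos hfmono hf hα
  have h1 := (tendsto_log_one_add_div_rpow one_pos).comp (tendsto_comp_cast_add_one hfpos hfmono hf)
  have h2 := ((tendsto_log_add_one_div hfpos hfmono hf).add h1).const_mul C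
  simp only [Function.comp, Real.rpow_one, add_zero, mul_zero] at h2
  refine squeeze_zero' ?_ ?_ h2
  · refine Eventually.of_forall fun n => ?_
    have := normSeq_pos (T := T) (α := α) hfpos n
    exact div_nonneg (Real.log_nonneg (by linarith)) (hfpos _ (one_le_cast_add_one n)).le
  · filter_upwards [hev] with n hn
    have := hfpos _ (one_le_cast_add_one n)
    rw [← add_div, ← mul_div_assoc]
    gcongr

/-- The count factor of w cancels `N`, leaving log(1 + w)/f^(1/α), and f ≤ f^(1/α) once f ≥ 1. It
handles index 1 for the dominant type, and for the other type in (a). -/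
theorem tendsto_count_mul_log_div (hα₁ : α ≤ 1) {N : ℕ → ℝ} (hN0 : ∀ n, 0 ≤ N n) {C : ℝ}
    (hN : ∀ᶠ n in atTop, N n ≤ C * ((Nat.count T n : ℝ) + 1) ^ (1 / α)) :
    Tendsto (fun n => N (n + 1) * Real.log (1 + normSeq T f α n) / normSeq T f α n)
      atTop (𝓝 0) := by
  have h1 := (tendsto_log_normSeq_div (T := T) hfpos hfmono hf hα).const_mul C
  rw [mul_zero] at h1
  refine squeeze_zero' ?_ ?_ h1
  · refine Eventually.of_forall fun n => ?_
    have h2 := normSeq_pos (T := T) (α := α) hfpos n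
    exact div_nonneg (mul_nonneg (hN0 _) (Real.log_nonneg (by linarith))) h2.le
  · filter_upwards [(tendsto_add_atTop_nat 1).eventually hN,
      (tendsto_comp_cast_add_one hfpos hfmono hf).eventually_ge_atTop 1] with n hn hf1
    have h2 := normSeq_pos (T := T) (α := α) hfpos n
    have hf0 := hfpos _ (one_le_cast_add_one n)
    have h3 : 0 ≤ Real.log (1 + normSeq T f α n) := Real.log_nonneg (by linarith)
    have h4 : f ((n : ℝ) + 1) ≤ f ((n : ℝ) + 1) ^ (1 / α) := by
      conv_lhs => rw [← Real.rpow_one (f ((n : ℝ) + 1))]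
      exact Real.rpow_le_rpow_of_exponent_le hf1 (by rw [le_div_iff₀ hα]; linarith)
    have hc0 : 0 ≤ C * ((Nat.count T (n + 1) : ℝ) + 1) ^ (1 / α) := (hN0 _).trans hn
    rw [← mul_div_assoc, div_le_div_iff₀ h2 hf0]
    calc N (n + 1) * Real.log (1 + normSeq T f α n) * f ((n : ℝ) + 1)
        ≤ C * ((Nat.count T (n + 1) : ℝ) + 1) ^ (1 / α) * Real.log (1 + normSeq T f α n) *
          f ((n : ℝ) + 1) ^ (1 / α) := by gcongr
      _ = _ := by rw [normSeq, Real.mul_rpow (by positivity) hf0.le]; ring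

/-- The count bound dominates w^(-α') by C/((N' + 1) f^(α'/α)), and f^(α'/α) ≥ f once f ≥ 1. -/
theorem summable_normSeq_of_count_compl_le (hαα' : α < α') {C : ℝ}
    (hN : ∀ᶠ n in atTop, (Nat.count (fun k => ¬ T k) n : ℝ) ≤
      C * ((Nat.count T n : ℝ) + 1) ^ (α' / α)) :
    Summable fun k => if ¬ T k then normSeq T f α k ^ (-α') else 0 := by
  have hs := summable_ite_one_div_count (T := fun k => ¬ T k) hfpos hfmono
    (summable_of_logIntegral hfpos hfmono hf)
  refine Summable.of_norm_bounded_eventually_nat (hs.mul_left C) ?_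
  filter_upwards [(tendsto_add_atTop_nat 1).eventually hN,
    (tendsto_comp_cast_add_one hfpos hfmono hf).eventually_ge_atTop 1] with k hk hf1
  by_cases hT : ¬ T k
  · have hf0 := hfpos _ (one_le_cast_add_one k)
    rw [if_pos hT, if_pos hT, Real.norm_of_nonneg (Real.rpow_nonneg (normSeq_pos hfpos k).le _),
      normSeq_rpow hfpos, neg_div, Real.rpow_neg (normSeq_base_pos hfpos k).le,
      Real.mul_rpow (by positivity) hf0.le, mul_one_div]
    rw [Nat.count_succ, if_pos hT] at hk
    push_cast at hk
    have h4 : f ((k : ℝ) + 1) ≤ f ((k : ℝ) + 1) ^ (α' / α) := by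
      conv_lhs => rw [← Real.rpow_one (f ((k : ℝ) + 1))]
      exact Real.rpow_le_rpow_of_exponent_le hf1 (by rw [le_div_iff₀ hα]; linarith)
    rw [inv_eq_one_div, div_le_div_iff₀ (by positivity) (by positivity), one_mul]
    have hc0 : 0 ≤ C * ((Nat.count T (k + 1) : ℝ) + 1) ^ (α' / α) := le_trans (by positivity) hk
    calc _ ≤ (C * ((Nat.count T (k + 1) : ℝ) + 1) ^ (α' / α)) * f ((k : ℝ) + 1) ^ (α' / α) := by
          gcongr
      _ = _ := by ring
  · rw [if_neg hT, if_neg hT]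
    simp

end Growth

theorem summable_one_div_mul_log_rpow {ρ : ℝ} (hρ : 1 < ρ) :
    Summable fun m : ℕ => 1 / (((m : ℝ) + 1) * Real.log ((m : ℝ) + 2) ^ ρ) := by
  have hpos : ∀ x : ℝ, 1 ≤ x → 0 < Real.log (x + 1) ^ ρ := fun x hx =>
    Real.rpow_pos_of_pos (Real.log_pos (by linarith)) _
  have hmono : MonotoneOn (fun x : ℝ => Real.log (x + 1) ^ ρ) (Set.Ici 1) := by
    intro x hx y _ hxy
    have hx' : (1 : ℝ) ≤ x := hx
    exact Real.rpow_le_rpow (Real.log_nonneg (by linarith))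
      (Real.log_le_log (by linarith) (by linarith)) (by linarith)
  have h := (summable_one_div_mul_pow_iff hpos hmono 1).2 ?_
  · refine h.congr fun m => ?_
    rw [pow_one, show (m : ℝ) + 1 + 1 = m + 2 by ring]
  · have h1 := (Real.summable_one_div_nat_rpow.2 hρ).mul_left (1 / Real.log 2 ^ ρ)
    refine Summable.of_norm_bounded_eventually_nat h1 ?_
    filter_upwards [eventually_ge_atTop 1] with i hi
    have hi0 : (0 : ℝ) < i := by exact_mod_cast hi
    have hl2 : 0 < Real.log 2 := Real.log_pos (by norm_num)
    have h2 : Real.log 2 * i ≤ Real.log (2 ^ i + 1) := by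
      rw [mul_comm, ← Real.log_pow]
      exact Real.log_le_log (by positivity) (by linarith)
    rw [one_mul, Real.norm_of_nonneg (one_div_pos.2 (hpos _ (one_le_pow₀ (by norm_num)))).le,
      div_mul_div_comm, one_mul, ← Real.mul_rpow hl2.le hi0.le]
    apply one_div_le_one_div_of_le (by positivity)
    exact Real.rpow_le_rpow (by positivity) h2 (by linarith)

/-! ### A sparse minority of smaller index -/

section Sparse
variable {f : ℝ → ℝ} (hfpos : ∀ x, 1 ≤ x → 0 < f x) (hfmono : MonotoneOn f (Set.Ici 1))
  (hf : logIntegral f < ∞) {T : ℕ → Prop} [DecidablePred T] {α α' μ : ℝ} (hα : 0 < α)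
  (hα' : 0 < α') (hμ0 : 0 < μ) (hμ : 1 < μ + α' / α)
  (hhalf : ∀ᶠ n : ℕ in atTop, (n : ℝ) ≤ 2 * ((Nat.count T n : ℝ) + 1))
  (hsparse : ∀ᶠ n : ℕ in atTop, (Nat.count (fun k => ¬ T k) n : ℝ) ≤
    (n : ℝ) ^ (α' / α) * Real.log n ^ (-μ))
include hfpos hfmono hf hα hα' hμ0 hμ hhalf hsparse

omit hμ0 in
-- Write θ = α'/α and ℓ = log(k + 1). Half density and f ≥ ℓ give w^(-α') = O((kℓ)^(-θ)), and
-- sparseness gives k^θ ≥ (N' + 1) ℓ^μ up to the shift. The terms are thus O(1/((N' + 1) ℓ^(μ+θ))),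
-- with μ + θ > 1.
theorem summable_normSeq_of_sparse :
    Summable fun k => if ¬ T k then normSeq T f α k ^ (-α') else 0 := by
  set θ := α' / α with hθ
  have hθ0 : 0 < θ := div_pos hα' hα
  have hs := summable_ite_count (p := fun k => ¬ T k)
    (h := fun m : ℕ => 1 / (((m : ℝ) + 1) * Real.log ((m : ℝ) + 2) ^ (μ + θ)))
    (fun m => (one_div_pos.2 (mul_pos (by positivity) (Real.rpow_pos_of_pos
      (Real.log_pos (by have : (0 : ℝ) ≤ m := Nat.cast_nonneg m
                        linarith)) _))).le)
    (summable_one_div_mul_log_rpow hμ)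
  refine Summable.of_norm_bounded_eventually_nat (hs.mul_left (2 ^ θ * 2 ^ (μ + θ))) ?_
  filter_upwards [(tendsto_add_atTop_nat 1).eventually hhalf,
    (tendsto_add_atTop_nat 1).eventually hsparse, eventually_log_le hfpos hfmono hf,
    eventually_ge_atTop 1] with k hk1 hk2 hk3 hk4
  by_cases hT : ¬ T k
  · have hf0 := hfpos _ (one_le_cast_add_one k)
    have hk0 : (1 : ℝ) ≤ k := by exact_mod_cast hk4
    rw [if_pos hT, if_pos hT, Real.norm_of_nonneg (Real.rpow_nonneg (normSeq_pos hfpos k).le _),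
      normSeq_rpow hfpos, neg_div, ← hθ, Real.rpow_neg (normSeq_base_pos hfpos k).le, mul_one_div]
    rw [Nat.count_succ, if_pos hT] at hk2
    push_cast at hk1 hk2
    set N := (Nat.count (fun k => ¬ T k) k : ℝ) with hN
    have hN0 : 0 ≤ N := Nat.cast_nonneg _
    have hNk : N ≤ k := Nat.cast_le.2 (Nat.count_le _)
    set ℓ := Real.log ((k : ℝ) + 1) with hℓ
    have hℓ0 : 0 < ℓ := Real.log_pos (by linarith)
    -- From N + 2 ≤ (k + 1)²; this passes from k to the count, so the series can be reindexed.
    have hlog : Real.log (N + 2) ≤ 2 * ℓ := by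
      rw [hℓ, show (2 : ℝ) = ((2 : ℕ) : ℝ) by norm_num, ← Real.log_pow]
      apply Real.log_le_log (by positivity)
      push_cast
      nlinarith
    have hlog0 : 0 < Real.log (N + 2) := Real.log_pos (by linarith)
    have e1 : Real.log (N + 2) ^ (μ + θ) ≤ 2 ^ (μ + θ) * ℓ ^ (μ + θ) := by
      rw [← Real.mul_rpow (by norm_num) hℓ0.le]
      exact Real.rpow_le_rpow hlog0.le hlog (by linarith)
    have e2 : ((k : ℝ) + 1) ^ θ * ℓ ^ θ ≤
        2 ^ θ * (((Nat.count T (k + 1) : ℝ) + 1) * f ((k : ℝ) + 1)) ^ θ := by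
      rw [← Real.mul_rpow (by positivity) hℓ0.le, ← Real.mul_rpow (by norm_num) (by positivity)]
      refine Real.rpow_le_rpow (by positivity) ?_ hθ0.le
      rw [← mul_assoc]
      gcongr
    have e3 : (N + 1) * ℓ ^ μ ≤ ((k : ℝ) + 1) ^ θ := by
      rw [Real.rpow_neg hℓ0.le, ← div_eq_mul_inv, le_div_iff₀ (by positivity)] at hk2
      exact hk2
    rw [inv_eq_one_div, div_le_div_iff₀ (by have := normSeq_base_pos (T := T) hfpos k
                                            positivity) (by positivity), one_mul]
    calc (N + 1) * Real.log (N + 2) ^ (μ + θ)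
        ≤ (N + 1) * (2 ^ (μ + θ) * ℓ ^ (μ + θ)) := by gcongr
      _ = 2 ^ (μ + θ) * (((N + 1) * ℓ ^ μ) * ℓ ^ θ) := by rw [Real.rpow_add hℓ0]; ring
      _ ≤ 2 ^ (μ + θ) * (((k : ℝ) + 1) ^ θ * ℓ ^ θ) := by gcongr
      _ ≤ 2 ^ (μ + θ) * (2 ^ θ * (((Nat.count T (k + 1) : ℝ) + 1) * f ((k : ℝ) + 1)) ^ θ) := by
          gcongr
      _ = _ := by ring
  · rw [if_neg hT, if_neg hT]
    simp

omit hα' in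
theorem tendsto_count_mul_log_div_of_sparse (hα₁ : α' = 1) :
    Tendsto (fun n => (Nat.count (fun k => ¬ T k) (n + 1) : ℝ) *
      Real.log (1 + normSeq T f α n) / normSeq T f α n) atTop (𝓝 0) := by
  rw [hα₁] at hμ hsparse
  set θ := 1 / α with hθ
  have hθ0 : 0 < θ := one_div_pos.2 hα
  obtain ⟨C, hC, hev⟩ := exists_eventually_log_normSeq_le (T := T) hfpos hfmono hf hα
  have hft := tendsto_comp_cast_add_one hfpos hfmono hf
  have hlt := tendsto_log_cast_add_one
  have h1 := (tendsto_log_one_add_div_rpow hθ0).comp hft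
  have h2 : Tendsto (fun n : ℕ => Real.log ((n : ℝ) + 1) ^ (-(μ + θ - 1))) atTop (𝓝 0) :=
    (tendsto_rpow_neg_atTop (by linarith)).comp hlt
  have h3 := (h2.add h1).const_mul (2 ^ θ * C)
  simp only [Function.comp, add_zero, mul_zero] at h3
  refine squeeze_zero' ?_ ?_ h3
  · refine Eventually.of_forall fun n => ?_
    have h2 := normSeq_pos (T := T) (α := α) hfpos n
    exact div_nonneg (mul_nonneg (Nat.cast_nonneg _) (Real.log_nonneg (by linarith))) h2.le
  · filter_upwards [(tendsto_add_atTop_nat 1).eventually hhalf,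
      (tendsto_add_atTop_nat 1).eventually hsparse, eventually_log_le hfpos hfmono hf,
      hlt.eventually_ge_atTop 1, hev] with k hk1 hk2 hk3 hk4 hk5
    push_cast at hk1 hk2
    have hf0 := hfpos _ (one_le_cast_add_one k)
    have hw := normSeq_pos (T := T) (α := α) hfpos k
    set N := (Nat.count (fun k => ¬ T k) (k + 1) : ℝ) with hN
    have hN0 : 0 ≤ N := Nat.cast_nonneg _
    set ℓ := Real.log ((k : ℝ) + 1) with hℓ
    have hℓ0 : 0 < ℓ := by linarith
    set y := f ((k : ℝ) + 1) with hy
    have hly : 0 ≤ Real.log (1 + y) := Real.log_nonneg (by linarith)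
    have e2 : ((k : ℝ) + 1) ^ θ * y ^ θ ≤ 2 ^ θ * normSeq T f α k := by
      rw [normSeq, ← Real.mul_rpow (by positivity) hf0.le,
        ← Real.mul_rpow (by norm_num) (by positivity)]
      refine Real.rpow_le_rpow (by positivity) ?_ hθ0.le
      rw [← mul_assoc]
      gcongr
    -- Split ℓ^(1-μ) as ℓ^θ ℓ^(-(μ+θ-1)) and absorb ℓ^θ into y^θ; the other factor tends to 0
    -- because μ + θ > 1.
    have e3 : ℓ ^ (-μ) * (ℓ + Real.log (1 + y)) ≤
        y ^ θ * (ℓ ^ (-(μ + θ - 1)) + Real.log (1 + y) / y ^ θ) := by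
      have p1 : ℓ ^ (-μ) ≤ 1 := Real.rpow_le_one_of_one_le_of_nonpos hk4 (by linarith)
      have p2 : ℓ ^ (-μ) * ℓ = ℓ ^ θ * ℓ ^ (-(μ + θ - 1)) := by
        nth_rw 2 [← Real.rpow_one ℓ]
        rw [← Real.rpow_add hℓ0, ← Real.rpow_add hℓ0]
        congr 1
        ring
      have p3 : ℓ ^ θ ≤ y ^ θ := Real.rpow_le_rpow hℓ0.le hk3 hθ0.le
      rw [mul_add, mul_add, p2, mul_div_cancel₀ _ (by positivity : y ^ θ ≠ 0)]
      have p4 : 0 ≤ ℓ ^ (-(μ + θ - 1)) := by positivity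
      nlinarith [mul_le_mul_of_nonneg_right p3 p4, mul_le_mul_of_nonneg_right p1 hly]
    rw [div_le_iff₀ hw]
    have q0 : 0 ≤ ℓ ^ (-(μ + θ - 1)) + Real.log (1 + y) / y ^ θ := by positivity
    calc N * Real.log (1 + normSeq T f α k)
        ≤ (((k : ℝ) + 1) ^ θ * ℓ ^ (-μ)) * (C * (ℓ + Real.log (1 + y))) :=
          mul_le_mul hk2 hk5 (Real.log_nonneg (by linarith)) (by positivity)
      _ = C * ((k : ℝ) + 1) ^ θ * (ℓ ^ (-μ) * (ℓ + Real.log (1 + y))) := by ring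
      _ ≤ C * ((k : ℝ) + 1) ^ θ * (y ^ θ * (ℓ ^ (-(μ + θ - 1)) + Real.log (1 + y) / y ^ θ)) := by
          gcongr
      _ = C * (ℓ ^ (-(μ + θ - 1)) + Real.log (1 + y) / y ^ θ) *
            (((k : ℝ) + 1) ^ θ * y ^ θ) := by ring
      _ ≤ C * (ℓ ^ (-(μ + θ - 1)) + Real.log (1 + y) / y ^ θ) * (2 ^ θ * normSeq T f α k) := by
          gcongr
      _ = _ := by ring

end Sparse

/-! ### Comparison of the counts and the final assembly -/

theorem sampleCount_eq_count {Ω : Type*} [MeasurableSpace Ω] (P : Measure Ω) (X : ℕ → Ω → ℝ)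
    (G : Measure ℝ) [DecidablePred fun k => P.map (X k) = G] :
    sampleCount P X G = Nat.count fun k => P.map (X k) = G := by
  funext n
  rw [sampleCount, Nat.count_eq_card_filter_range]
  congr

theorem natCast_rpow_eq_ofReal (n : ℕ) {r : ℝ} (hr : 0 ≤ r) :
    (n : ℝ≥0∞) ^ r = ENNReal.ofReal ((n : ℝ) ^ r) := by
  rw [← ENNReal.ofReal_rpow_of_nonneg (Nat.cast_nonneg n) hr, ENNReal.ofReal_natCast]

section Ratio
variable {N₁ N₂ : ℕ → ℕ} {α₁ α₂ : ℝ} {lam : ℝ≥0∞} (hα₁ : 0 < α₁) (hα₂ : 0 < α₂)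
  (hN₂ : Tendsto N₂ atTop atTop)
  (hlam : Tendsto (fun n : ℕ => (N₁ n : ℝ≥0∞) ^ α₂ / (N₂ n : ℝ≥0∞) ^ α₁) atTop (𝓝 lam))
include hα₁ hα₂ hN₂ hlam

theorem exists_eventually_le_rpow_of_pos (h0 : 0 < lam) :
    ∃ C, 0 < C ∧ ∀ᶠ n in atTop, (N₂ n : ℝ) ≤ C * (N₁ n : ℝ) ^ (α₂ / α₁) := by
  -- A finite r strictly between 0 and the limit treats finite and infinite limits alike.
  obtain ⟨r, hr0, hr⟩ := ENNReal.lt_iff_exists_nnreal_btwn.1 h0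
  have hr0' : 0 < (r : ℝ) := by exact_mod_cast hr0
  refine ⟨(1 / (r : ℝ)) ^ (1 / α₁), by positivity, ?_⟩
  filter_upwards [hlam.eventually_const_lt hr, hN₂.eventually_ge_atTop 1] with n hn hn2
  have h2 : (0 : ℝ) < N₂ n := by exact_mod_cast hn2
  have h2p : 0 < (N₂ n : ℝ) ^ α₁ := by positivity
  rw [natCast_rpow_eq_ofReal _ hα₁.le, natCast_rpow_eq_ofReal _ hα₂.le,
    ← ENNReal.ofReal_div_of_pos h2p, ← ENNReal.ofReal_coe_nnreal] at hn
  have h3 := (ENNReal.ofReal_lt_ofReal_iff_of_nonneg hr0'.le).1 hn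
  rw [lt_div_iff₀ h2p] at h3
  calc (N₂ n : ℝ) = ((N₂ n : ℝ) ^ α₁) ^ (1 / α₁) := by
        rw [← Real.rpow_mul h2.le, mul_one_div_cancel hα₁.ne', Real.rpow_one]
    _ ≤ (1 / (r : ℝ) * (N₁ n : ℝ) ^ α₂) ^ (1 / α₁) := by
        refine Real.rpow_le_rpow h2p.le ?_ (by positivity)
        rw [one_div_mul_eq_div, le_div_iff₀ hr0']
        linarith
    _ = _ := by
        rw [Real.mul_rpow (by positivity) (by positivity), ← Real.rpow_mul (Nat.cast_nonneg _),
          mul_one_div]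

theorem eventually_le_rpow_of_eq_zero (h0 : lam = 0) :
    ∀ᶠ n in atTop, (N₁ n : ℝ) ≤ (N₂ n : ℝ) ^ (α₁ / α₂) := by
  rw [h0] at hlam
  filter_upwards [hlam.eventually_lt_const one_pos, hN₂.eventually_ge_atTop 1] with n hn hn2
  have h2 : (0 : ℝ) < N₂ n := by exact_mod_cast hn2
  have h2p : 0 < (N₂ n : ℝ) ^ α₁ := by positivity
  rw [natCast_rpow_eq_ofReal _ hα₁.le, natCast_rpow_eq_ofReal _ hα₂.le,
    ← ENNReal.ofReal_div_of_pos h2p, ← ENNReal.ofReal_one] at hn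
  have h3 := (ENNReal.ofReal_lt_ofReal_iff one_pos).1 hn
  rw [div_lt_one h2p] at h3
  calc (N₁ n : ℝ) = ((N₁ n : ℝ) ^ α₂) ^ (1 / α₂) := by
        rw [← Real.rpow_mul (Nat.cast_nonneg _), mul_one_div_cancel hα₂.ne', Real.rpow_one]
    _ ≤ ((N₂ n : ℝ) ^ α₁) ^ (1 / α₂) :=
        Real.rpow_le_rpow (by positivity) h3.le (by positivity)
    _ = _ := by rw [← Real.rpow_mul h2.le, mul_one_div]

end Ratio

theorem ae_dichotomy {Ω : Type*} [MeasurableSpace Ω] {P : Measure Ω} {F : Ω → ℝ≥0∞} {I : ℝ≥0∞}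
    (h1 : I < ∞ → ∀ᵐ ω ∂P, F ω = 0) (h2 : I = ∞ → ∀ᵐ ω ∂P, F ω = ∞) :
    ∀ᵐ ω ∂P, (F ω = 0 ↔ I < ∞) ∧ (F ω = ∞ ↔ I = ∞) := by
  rcases eq_or_ne I ∞ with hI | hI
  · filter_upwards [h2 hI] with ω hω
    simp [hω, hI]
  · filter_upwards [h1 hI.lt_top] with ω hω
    simp [hω, hI, hI.lt_top]

/-- Only an inequality, since an index may satisfy both predicates. -/
theorem count_le_count_add_count {T₁ T₂ : ℕ → Prop} [DecidablePred T₁] [DecidablePred T₂]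
    (hT : ∀ k, T₁ k ∨ T₂ k) (n : ℕ) : n ≤ Nat.count T₁ n + Nat.count T₂ n := by
  induction n with
  | zero => simp
  | succ n ih =>
    rw [Nat.count_succ, Nat.count_succ]
    rcases hT n with h | h <;> simp only [h, if_true] <;> split_ifs <;> omega

theorem mainTheorem1 {Ω : Type*} [MeasurableSpace Ω] (P : Measure Ω) [IsProbabilityMeasure P]
    (α₁ α₂ c₁ c₂ : ℝ) (hα₁ : 0 < α₁) (hα₁₂ : α₁ < α₂) (hα₂ : α₂ < 2)
    (hc₁ : 0 < c₁) (hc₂ : 0 < c₂)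
    (G₁ G₂ : Measure ℝ) [IsProbabilityMeasure G₁] [IsProbabilityMeasure G₂]
    (hG₁ : InDomainOfNormalAttraction G₁ α₁ c₁) (hG₂ : InDomainOfNormalAttraction G₂ α₂ c₂)
    (X : ℕ → Ω → ℝ) (hXm : ∀ k, Measurable (X k)) (hXind : iIndepFun X P)
    (hXlaw : ∀ k, P.map (X k) = G₁ ∨ P.map (X k) = G₂)
    (hτ₁ : Tendsto (sampleCount P X G₁) atTop atTop)
    (hτ₂ : Tendsto (sampleCount P X G₂) atTop atTop)
    (A B : ℕ → ℝ) (hB : ∀ n, 0 < B n)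
    (L : Measure ℝ) [IsProbabilityMeasure L] (hL : ∀ x : ℝ, L ≠ Measure.dirac x)
    (hlim : TendstoInDistribution (fun (n : ℕ) (ω : Ω) => (partialSum X n ω - A n) / B n)
      atTop (id : ℝ → ℝ) (fun _ => P) L)
    (lam : ℝ≥0∞)
    (hlam : Tendsto (fun n : ℕ =>
      (sampleCount P X G₁ n : ℝ≥0∞) ^ α₂ / (sampleCount P X G₂ n : ℝ≥0∞) ^ α₁) atTop (𝓝 lam))
    (f : ℝ → ℝ) (hfpos : ∀ x, 1 ≤ x → 0 < f x) (hfmono : MonotoneOn f (Set.Ici 1)) :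
    (0 < lam →
      ∀ᵐ ω ∂P, (normedLimsup X B f α₁ ω = 0 ↔ logIntegral f < ∞) ∧
        (normedLimsup X B f α₁ ω = ∞ ↔ logIntegral f = ∞)) ∧
    (lam = 0 →
      (∃ μ : ℝ, (α₂ - α₁) / α₂ < μ ∧ ∀ᶠ n : ℕ in atTop,
        (sampleCount P X G₁ n : ℝ) < (n : ℝ) ^ (α₁ / α₂) * Real.log n ^ (-μ)) →
      ∀ᵐ ω ∂P, (normedLimsup X B f α₂ ω = 0 ↔ logIntegral f < ∞) ∧
        (normedLimsup X B f α₂ ω = ∞ ↔ logIntegral f = ∞)) := by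
  classical
  have hα₁' : α₁ < 2 := hα₁₂.trans hα₂
  have hα₂' : 0 < α₂ := hα₁.trans hα₁₂
  set T₁ : ℕ → Prop := fun k => P.map (X k) = G₁ with hT₁
  set T₂ : ℕ → Prop := fun k => P.map (X k) = G₂ with hT₂
  have hT : ∀ k, T₁ k ∨ T₂ k := hXlaw
  rw [sampleCount_eq_count] at hτ₁ hτ₂
  simp only [sampleCount_eq_count] at hlam ⊢
  obtain ⟨K₁, hK₁, hTB₁⟩ := hG₁.exists_truncationBounds hα₁ hα₁'
  obtain ⟨K₂, hK₂, hTB₂⟩ := hG₂.exists_truncationBounds hα₂' hα₂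
  obtain ⟨Q₁, hQ₁, hφ₁⟩ := hG₁.exists_one_sub_norm_sq_le hα₁
  obtain ⟨Q₂, hQ₂, hφ₂⟩ := hG₂.exists_one_sub_norm_sq_le hα₂'
  obtain ⟨κ₁, hκ₁, htail₁⟩ := hG₁.exists_le_tail hα₁ hα₁' hc₁
  obtain ⟨κ₂, hκ₂, htail₂⟩ := hG₂.exists_le_tail hα₂' hα₂ hc₂
  have hcover := count_le_count_add_count hT
  have hupper : ∀ b : ℕ → ℝ, (∀ n, 0 < b n) → ∀ C : ℝ,
      (∀ᶠ n in atTop, (Nat.count T₁ n : ℝ) ≤ C * b n ^ α₁) →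
      (∀ᶠ n in atTop, (Nat.count T₂ n : ℝ) ≤ C * b n ^ α₂) →
      ∃ D, 0 < D ∧ ∀ᶠ n in atTop, B n ≤ D * b n := fun b hb C hc1 hc2 =>
    exists_eventually_norming_le hXm hXind hB hL hlim hT hα₁ hα₂' (hK := add_nonneg hQ₁ hQ₂)
      (fun k hk s => by
        have h1 : P.map (X k) = G₁ := hk
        rw [h1]
        exact (hφ₁ s).trans (mul_le_mul_of_nonneg_right (by linarith) (by positivity)))
      (fun k hk s => by
        have h1 : P.map (X k) = G₂ := hk
        rw [h1]
        exact (hφ₂ s).trans (mul_le_mul_of_nonneg_right (by linarith) (by positivity)))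
      hb hc1 hc2
  have hroot : ∀ (N : ℕ) (α β : ℝ), (((N : ℝ) + 1) ^ (1 / α)) ^ β = ((N : ℝ) + 1) ^ (β / α) := by
    intro N α β
    rw [← Real.rpow_mul (by positivity)]
    congr 1
    ring
  refine ⟨fun hlam0 => ?_, fun hlam0 ⟨μ, hμ, hsp⟩ => ?_⟩
  · -- the variables with law `G₁` dominate
    obtain ⟨C, hC, hN₂⟩ := exists_eventually_le_rpow_of_pos hα₁ hα₂' hτ₂ hlam hlam0
    have hN₂' : ∀ᶠ n in atTop, (Nat.count T₂ n : ℝ) ≤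
        C * ((Nat.count T₁ n : ℝ) + 1) ^ (α₂ / α₁) := by
      filter_upwards [hN₂] with n hn
      refine hn.trans ?_
      gcongr
      linarith
    have hlaw' : ∀ k, ¬ T₁ k → P.map (X k) = G₂ := fun k hk => (hT k).resolve_left hk
    have hcompl : ∀ᶠ n in atTop, (Nat.count (fun k => ¬ T₁ k) n : ℝ) ≤
        C * ((Nat.count T₁ n : ℝ) + 1) ^ (α₂ / α₁) := by
      filter_upwards [hN₂'] with n hn
      refine le_trans ?_ hn
      exact_mod_cast Nat.count_mono_left fun k _ hk => hlaw' k hk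
    refine ae_dichotomy (fun hI => ?_) fun hI => ?_
    · obtain ⟨D, hD, hBD⟩ := exists_eventually_le_norming hXm hXind hB hlim (T := T₁)
        (fun k hk => hk) hτ₁ hc₁ hG₁
      refine ae_normedLimsup_eq_zero hXm hXind hB (T := T₁) (fun k hk => hk) hlaw' hτ₁ hα₁ hK₁ hK₂
        hTB₁ hTB₂ hfpos hfmono hBD
        (summable_normSeq_rpow_neg_self hα₁ hfpos hfmono (summable_of_logIntegral hfpos hfmono hI))
        (summable_normSeq_of_count_compl_le hfpos hfmono hI hα₁ hα₁₂ hcompl)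
        (fun h1 => tendsto_count_mul_log_div hfpos hfmono hI hα₁ h1.le
          (N := fun n => (Nat.count T₁ n : ℝ)) (fun n => Nat.cast_nonneg _) (C := 1) ?_)
        (fun h1 => tendsto_count_mul_log_div hfpos hfmono hI hα₁ (by linarith)
          (N := fun n => (Nat.count (fun k => ¬ T₁ k) n : ℝ)) (fun n => Nat.cast_nonneg _)
          (C := C) (by rw [h1] at hcompl; exact hcompl))
      refine Eventually.of_forall fun n => ?_
      rw [h1, div_one, Real.rpow_one, one_mul]
      linarith
    · obtain ⟨D, hD, hBD⟩ := hupper (fun n => ((Nat.count T₁ n : ℝ) + 1) ^ (1 / α₁))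
        (fun n => by positivity) (C + 1)
        (Eventually.of_forall fun n => by
          rw [hroot, div_self hα₁.ne', Real.rpow_one]
          have : (0 : ℝ) ≤ Nat.count T₁ n := Nat.cast_nonneg _
          nlinarith)
        (by
          filter_upwards [hN₂'] with n hn
          rw [hroot]
          refine hn.trans ?_
          gcongr
          linarith)
      set r := α₂ / α₁ with hr
      have hr1 : 1 ≤ r := by rw [hr, le_div_iff₀ hα₁]; linarith
      -- Both counts are O(N^r), hence so is k; the extra 1 in the exponent absorbs the constant
      -- once N is large.
      refine ae_normedLimsup_eq_top hXm hXind hB (T := T₁) (fun k hk => hk) hτ₁ hα₁ hκ₁ htail₁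
        hfpos hfmono (p := ⌈r + 1⌉₊) ?_ (not_summable_of_logIntegral hfpos hfmono hI ?_) hD hBD
      · filter_upwards [(tendsto_add_atTop_nat 1).eventually hN₂',
          (tendsto_natCast_atTop_atTop.comp hτ₁).eventually_ge_atTop (2 ^ r * C + 1)]
          with k hk hk2 hTk
        have hc := hcover (k + 1)
        have hc' : (k : ℝ) + 1 ≤ Nat.count T₁ (k + 1) + Nat.count T₂ (k + 1) := by exact_mod_cast hc
        have hs : (Nat.count T₁ (k + 1) : ℝ) = Nat.count T₁ k + 1 := by
          rw [Nat.count_succ, if_pos hTk]; push_cast; rfl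
        rw [hs] at hk hc'
        set N := (Nat.count T₁ k : ℝ) with hN
        have hk2' : 2 ^ r * C + 1 ≤ N := hk2
        have hN0 : 0 ≤ N := Nat.cast_nonneg _
        have h1 : (N + 1 + 1) ^ r ≤ 2 ^ r * (N + 1) ^ r := by
          rw [← Real.mul_rpow (by norm_num) (by positivity)]
          exact Real.rpow_le_rpow (by positivity) (by linarith) (by linarith)
        have h2 : N + 1 ≤ (N + 1) ^ r := by
          conv_lhs => rw [← Real.rpow_one (N + 1)]
          exact Real.rpow_le_rpow_of_exponent_le (by linarith) hr1
        calc (k : ℝ) + 1 ≤ N + 1 + C * (N + 1 + 1) ^ r := by linarith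
          _ ≤ (N + 1) ^ r + C * (2 ^ r * (N + 1) ^ r) := by gcongr
          _ = (1 + 2 ^ r * C) * (N + 1) ^ r := by ring
          _ ≤ (N + 1) * (N + 1) ^ r := mul_le_mul_of_nonneg_right (by linarith) (by positivity)
          _ = (N + 1) ^ (r + 1) := by rw [Real.rpow_add_one (by positivity), mul_comm]
          _ ≤ (N + 1) ^ ((⌈r + 1⌉₊ : ℕ) : ℝ) :=
              Real.rpow_le_rpow_of_exponent_le (by linarith) (Nat.le_ceil _)
          _ = _ := Real.rpow_natCast _ _
      · exact (Nat.ceil_pos.2 (by linarith)).ne'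
  · -- the variables with law `G₂` dominate
    have hN₁ := eventually_le_rpow_of_eq_zero hα₁ hα₂' hτ₂ hlam hlam0
    have hθ1 : α₁ / α₂ ≤ 1 := by rw [div_le_one hα₂']; exact hα₁₂.le
    have hθ0 : 0 < α₁ / α₂ := div_pos hα₁ hα₂'
    -- Since α₁/α₂ ≤ 1, the first count is eventually at most the second, which is therefore at
    -- least n/2.
    have hhalf : ∀ᶠ n : ℕ in atTop, (n : ℝ) ≤ 2 * (Nat.count T₂ n : ℝ) := by
      filter_upwards [hN₁, hτ₂.eventually_ge_atTop 1] with n hn hn2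
      have h1 : (1 : ℝ) ≤ Nat.count T₂ n := by exact_mod_cast hn2
      have h2 : (Nat.count T₂ n : ℝ) ^ (α₁ / α₂) ≤ Nat.count T₂ n := by
        conv_rhs => rw [← Real.rpow_one (Nat.count T₂ n : ℝ)]
        exact Real.rpow_le_rpow_of_exponent_le h1 hθ1
      have hc : (n : ℝ) ≤ Nat.count T₁ n + Nat.count T₂ n := by exact_mod_cast hcover n
      linarith
    have hlaw' : ∀ k, ¬ T₂ k → P.map (X k) = G₁ := fun k hk => (hT k).resolve_right hk
    refine ae_dichotomy (fun hI => ?_) fun hI => ?_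
    · obtain ⟨D, hD, hBD⟩ := exists_eventually_le_norming hXm hXind hB hlim (T := T₂)
        (fun k hk => hk) hτ₂ hc₂ hG₂
      -- This is the assumed lower bound on μ in the form needed for the logarithmic series.
      have hμθ : 1 < μ + α₁ / α₂ := by
        rw [sub_div, div_self hα₂'.ne'] at hμ; linarith
      have hμ0 : 0 < μ := by linarith
      have hhalf' : ∀ᶠ n : ℕ in atTop, (n : ℝ) ≤ 2 * ((Nat.count T₂ n : ℝ) + 1) :=
        hhalf.mono fun n hn => by linarith
      have hsparse : ∀ᶠ n : ℕ in atTop, (Nat.count (fun k => ¬ T₂ k) n : ℝ) ≤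
          (n : ℝ) ^ (α₁ / α₂) * Real.log n ^ (-μ) := by
        filter_upwards [hsp] with n hn
        refine le_trans ?_ hn.le
        exact_mod_cast Nat.count_mono_left fun k _ hk => hlaw' k hk
      refine ae_normedLimsup_eq_zero hXm hXind hB (T := T₂) (fun k hk => hk) hlaw' hτ₂ hα₂' hK₂ hK₁
        hTB₂ hTB₁ hfpos hfmono hBD
        (summable_normSeq_rpow_neg_self hα₂' hfpos hfmono (summable_of_logIntegral hfpos hfmono hI))
        (summable_normSeq_of_sparse hfpos hfmono hI hα₂' hα₁ hμθ hhalf' hsparse)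
        (fun h1 => tendsto_count_mul_log_div hfpos hfmono hI hα₂' h1.le
          (N := fun n => (Nat.count T₂ n : ℝ)) (fun n => Nat.cast_nonneg _) (C := 1) ?_)
        (fun h1 => tendsto_count_mul_log_div_of_sparse hfpos hfmono hI hα₂' hμ0 hμθ hhalf'
          hsparse h1)
      refine Eventually.of_forall fun n => ?_
      rw [h1, div_one, Real.rpow_one, one_mul]
      linarith
    · obtain ⟨D, hD, hBD⟩ := hupper (fun n => ((Nat.count T₂ n : ℝ) + 1) ^ (1 / α₂))
        (fun n => by positivity) 1
        (by
          filter_upwards [hN₁] with n hn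
          rw [hroot, one_mul]
          refine hn.trans ?_
          gcongr
          linarith)
        (Eventually.of_forall fun n => by
          rw [hroot, div_self hα₂'.ne', Real.rpow_one]
          linarith)
      -- Exponent 2 suffices: k + 1 ≤ 2(N + 1) ≤ (N + 1)² once N ≥ 1.
      refine ae_normedLimsup_eq_top hXm hXind hB (T := T₂) (fun k hk => hk) hτ₂ hα₂' hκ₂ htail₂
        hfpos hfmono (p := 2) ?_ (not_summable_of_logIntegral hfpos hfmono hI two_ne_zero) hD hBD
      filter_upwards [(tendsto_add_atTop_nat 1).eventually hhalf, hτ₂.eventually_ge_atTop 1]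
        with k hk hk2 hTk
      rw [Nat.count_succ, if_pos hTk] at hk
      push_cast at hk
      have h1 : (1 : ℝ) ≤ Nat.count T₂ k := by exact_mod_cast hk2
      nlinarith
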